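/- Let $n\ge 2$, let $\Omega_1',\dots,\Omega_n'$ be finite sets, let $\mu$ be a probability distribution on $\Omega_1'\times\cdots\times\Omega_n'$, and let $C>0$ be real. Let $\Omega=\bigsqcup_{i=1}^n\Omega_i'$, and let $\mu^{\mathrm{hom}}$ be the homogenization of $\mu$: the image of $\mu$ on $\binom{\Omega}{n}$ (the $n$-element subsets of $\Omega$) under $x\mapsto\{(x_1,1),\dots,(x_n,n)\}$. For $k\ge\ell$ let $D_{k\to\ell}$ be the Markov kernel from $\binom{\Omega}{k}$ to $\binom{\Omega}{\ell}$ with $D_{k\to\ell}(A,B)=\mathbf 1_{B\subseteq A}/\binom{k}{\ell}$, and let $\mu_\ell=\mu^{\mathrm{hom}}D_{n\to\ell}$. Let $U_{1\to2}(B,A)=\mathbf 1_{B\subseteq A}\,\mu_2(A)/\sum_{A'\supseteq B}\mu_2(A')$, for $B$ in the support of $\mu_1$, and let $P_{1\leftrightarrow2}=U_{1\to2}D_{2\to1}$ be the $1\leftrightarrow2$ up-down walk, a Markov chain on the support of $\mu_1$ that is reversible with respect to $\mu_1$. Let $\lambda_2(P_{1\leftrightarrow 2})$ be its second largest eigenvalue,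 counted with multiplicity. For $f(t)=(t-1)^2$ ($\chi^2$) or $f(t)=t\ln t$ (KL), put $D_f(\nu\|\pi)=\sum_x \pi(x) f(\nu(x)/\pi(x))$. A kernel $P$ satisfies $\rho$-contraction in $f$-divergence with respect to $\pi$ if $D_f(\nu P\|\pi P)\le\rho\,D_f(\nu\|\pi)$ for all probability distributions $\nu\ll\pi$. Contraction of $D_{k\to\ell}$ is understood with respect to $\mu_k$ (so with respect to $\mu^{\mathrm{hom}}$ if $k=n$). 1. If $D_{n\to n-1}$ satisfies $\left(1-\frac1{Cn}\right)$-contraction in $\chi^2$-divergence, then $D_{2\to1}$ satisfies $\left(1-\frac1{2(C+1)}\right)$-contraction in $\chi^2$-divergence, and $\lambda_2(P_{1\leftrightarrow2})\le 1-\frac1{2(C+1)}$. 2. If $D_{n\to n-1}$ satisfies $\left(1-\frac1{Cn}\right)$-contraction in KL-divergence (that is, $\mu$ satisfies $C$-approximate tensorization of entropy), then $D_{2\to1}$ satisfies $\left(1-\frac1{2(C+1)}\right)$-contraction in KL-divergence. -/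

import Mathlib

open scoped Matrix

noncomputable section

namespace DownUp

/-- `Slice α k` is the finite set of all `k`-element subsets of `α`. -/
abbrev Slice (α : Type*) (k : ℕ) : Type _ := {s : Finset α // s.card = k}

/-- The down operator from `k`-subsets to `l`-subsets: drop a uniformly random set of elements so
that `l` remain. Its entry at `(A, B)` is `1 / (k choose l)` if `B ⊆ A`, and `0` otherwise. -/
def down (α : Type*) [DecidableEq α] (k l : ℕ) : Matrix (Slice α k) (Slice α l) ℝ :=
  Matrix.of fun A B => if B.1 ⊆ A.1 then 1 / (k.choose l : ℝ) else 0

/-- The up operator from `l`-subsets to `k`-subsets with respect to `μ` on `k`-subsets. Its entry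
at `(B, A)` is `μ A / ∑ A' ⊇ B, μ A'` if `B ⊆ A`, and `0` otherwise. The rows that carry
probabilistic meaning are those `B` whose denominator is nonzero. -/
def up {α : Type*} [Fintype α] [DecidableEq α] {k : ℕ} (l : ℕ) (μ : Slice α k → ℝ) :
    Matrix (Slice α l) (Slice α k) ℝ :=
  Matrix.of fun B A =>
    if B.1 ⊆ A.1 then μ A / ∑ A' : Slice α k with B.1 ⊆ A'.1, μ A' else 0

/-- The distribution `μ_l = μ D_{k → l}` on `l`-subsets. -/
def marginal {α : Type*} [Fintype α] [DecidableEq α] {k : ℕ} (l : ℕ) (μ : Slice α k → ℝ) :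
    Slice α l → ℝ :=
  μ ᵥ* down α k l

/-- The `l ↔ k` up-down walk `U_{l → k} D_{k → l}` with respect to `μ` on `k`-subsets, as a Markov
chain on the support of its stationary distribution `μ_l` (the support is a closed class). -/
def upDownWalk {α : Type*} [Fintype α] [DecidableEq α] {k : ℕ} (l : ℕ) (μ : Slice α k → ℝ) :
    Matrix {B : Slice α l // marginal l μ B ≠ 0} {B : Slice α l // marginal l μ B ≠ 0} ℝ :=
  (up l μ * down α k l).submatrix Subtype.val Subtype.val

/-- The second largest eigenvalue, counted with multiplicity, of a square real matrix with real
spectrum (such as the transition matrix of a reversible chain): the entry of index `1` in the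
decreasing list of the roots of the characteristic polynomial. The value `1` is used if the list
has fewer than two entries. -/
def lambda2 {ι : Type*} [Fintype ι] [DecidableEq ι] (M : Matrix ι ι ℝ) : ℝ :=
  (M.charpoly.roots.sort (· ≥ ·)).getD 1 1

/-- The point `x` of the product, as the `n`-element set `{(1, x 1), …, (n, x n)}` in the disjoint
union of the factors. -/
def toSlice {n : ℕ} {S : Fin n → Type*} (x : ∀ i, S i) : Slice (Σ i, S i) n :=
  ⟨Finset.univ.map ⟨fun i => ⟨i, x i⟩, fun _ _ h => congrArg Sigma.fst h⟩, by simp⟩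

/-- The homogenization of `μ`: its image under `toSlice`. -/
def hom {n : ℕ} {S : Fin n → Type*} [∀ i, Fintype (S i)] [∀ i, DecidableEq (S i)]
    (μ : (∀ i, S i) → ℝ) : Slice (Σ i, S i) n → ℝ :=
  fun A => ∑ x : ∀ i, S i with toSlice x = A, μ x

/-- The `f`-divergence `E_{x ∼ μ} f (ν x / μ x)` on a finite set. -/
def fDiv {X : Type*} [Fintype X] (f : ℝ → ℝ) (ν μ : X → ℝ) : ℝ :=
  ∑ x, μ x * f (ν x / μ x)

/-- The generator of the `χ²`-divergence. -/
def chiSq (t : ℝ) : ℝ := (t - 1) ^ 2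

/-- The generator of the KL-divergence (with `0 log 0 = 0`). -/
def kl (t : ℝ) : ℝ := t * Real.log t

/-- `P` satisfies `ρ`-contraction in `f`-divergence with respect to `μ`: for all probability
distributions `ν ≪ μ`, `D_f(ν P ‖ μ P) ≤ ρ D_f(ν ‖ μ)`. -/
def Contracts {X Y : Type*} [Fintype X] [Fintype Y] (f : ℝ → ℝ) (ρ : ℝ) (P : Matrix X Y ℝ)
    (μ : X → ℝ) : Prop :=
  ∀ ν ∈ stdSimplex ℝ X, (∀ x, μ x = 0 → ν x = 0) →
    fDiv f (ν ᵥ* P) (μ ᵥ* P) ≤ ρ * fDiv f ν μ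

end DownUp

end

noncomputable section

namespace DownUp

/-! The law `marginal 2 (hom μ)` is the uniform mixture, over pairs `e` of coordinates, of the
marginals of `μ` on `e`. These live on disjoint blocks, so the divergence of `ν` with density `h` is
an average over `e` of two terms: `f (a e)`, where `a e` is the mean of `h` on block `e`, and the
entropy (`excess`) of `h` inside the block. After the down step the blocks are single coordinates
`i`, with mean `vertexAvg a i`, the average of `a` over the edges at `i` in the complete graph, and
with density the average of those coming from these edges.

The two terms contract separately. The means contract by `1/2`, an inequality on the complete graph
(`chiSq_edge`, `kl_edge`). For the entropies, convexity of `excess` (`excess_push_avg_le`) reduces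
to a single pair `e`. There the hypothesis is tested on a density depending only on `e`: deleting
any of the `n - 2` coordinates outside `e` loses nothing, and deleting one inside still shows the
other, so tensorization passes to the pair with factor `2 - 1/C` (`sum_fDiv_single_le`), that is,
contraction by `1 - 1/(2C)`. Both rates are at most `1 - 1/(2(C+1))`; `contracts_two_one` combines
them.

For the eigenvalue, χ²-contraction of a kernel bounds the norm of its adjoint, the up operator, on
mean-zero functions. By duality the down operator obeys the same bound (`sum_sq_down_le`), and its
squared norm is the quadratic form of the up-down walk. -/

/-- The pushforward of a mass function along a map of finite types. -/
def push {X T : Type*} [Fintype X] [DecidableEq T] (π : X → T) (μ : X → ℝ) : T → ℝ :=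
  fun t => ∑ x with π x = t, μ x

/-! ### Sums over the fibres of a map. -/

section push

variable {X T Z : Type*} [Fintype X] [DecidableEq T] [DecidableEq Z]

theorem push_nonneg {π : X → T} {μ : X → ℝ} (hμ : ∀ x, 0 ≤ μ x) (t : T) : 0 ≤ push π μ t :=
  Finset.sum_nonneg fun x _ => hμ x

theorem sum_push [Fintype T] (π : X → T) (μ : X → ℝ) : ∑ t, push π μ t = ∑ x, μ x :=
  Finset.sum_fiberwise _ _ _

theorem sum_push_mul [Fintype T] (π : X → T) (μ : X → ℝ) (F : T → ℝ) :
    ∑ t, push π μ t * F t = ∑ x, μ x * F (π x) := by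
  rw [← Finset.sum_fiberwise Finset.univ π]
  refine Finset.sum_congr rfl fun t _ => ?_
  rw [push, Finset.sum_mul]
  refine Finset.sum_congr rfl fun x hx => ?_
  rw [(Finset.mem_filter.1 hx).2]

theorem push_push [Fintype T] (π : X → T) (τ : T → Z) (μ : X → ℝ) :
    push τ (push π μ) = push (τ ∘ π) μ := by
  funext z
  have := sum_push_mul π μ (fun t => if τ t = z then 1 else 0)
  simpa [push, Finset.sum_filter] using this

theorem push_eq_zero_of_push_eq_zero {π : X → T} {μ ν : X → ℝ} (hμ : ∀ x, 0 ≤ μ x)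
    (hac : ∀ x, μ x = 0 → ν x = 0) {t : T} (h : push π μ t = 0) : push π ν t = 0 := by
  have := (Finset.sum_eq_zero_iff_of_nonneg fun x _ => hμ x).1 h
  exact Finset.sum_eq_zero fun x hx => hac x (this x hx)

theorem push_mul_comp (π : X → T) (μ : X → ℝ) (h : T → ℝ) (t : T) :
    push π (fun x => μ x * h (π x)) t = push π μ t * h t := by
  rw [push, push, Finset.sum_mul]
  refine Finset.sum_congr rfl fun x hx => ?_
  rw [(Finset.mem_filter.1 hx).2]

theorem push_sum {ι : Type*} (s : Finset ι) (π : X → T) (ν : ι → X → ℝ) (c : ℝ) :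
    push π (fun x => c * ∑ i ∈ s, ν i x) = fun t => c * ∑ i ∈ s, push π (ν i) t := by
  funext t
  simp only [push]
  rw [← Finset.mul_sum, Finset.sum_comm]

theorem push_const_mul (π : X → T) (c : ℝ) (ν : X → ℝ) :
    push π (fun x => c * ν x) = fun t => c * push π ν t := by
  funext t
  simp only [push, Finset.mul_sum]

theorem push_apply_ne_zero {π : X → T} {μ : X → ℝ} {t : T} (h : push π μ t ≠ 0) :
    ∃ x, π x = t := by
  obtain ⟨x, hx, -⟩ := Finset.exists_ne_zero_of_sum_ne_zero h
  exact ⟨x, (Finset.mem_filter.1 hx).2⟩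

end push

/-! ### Data processing, block decomposition and entropy for `f`-divergences. -/

section fDiv

variable {X T Z : Type*} [Fintype X] [Fintype T] [DecidableEq T] [Fintype Z] [DecidableEq Z]
  {f : ℝ → ℝ}

theorem fDiv_mul_right (f : ℝ → ℝ) (μ h : X → ℝ) :
    fDiv f (fun x => μ x * h x) μ = ∑ x, μ x * f (h x) := by
  refine Finset.sum_congr rfl fun x _ => ?_
  by_cases hx : μ x = 0
  · simp [hx]
  · rw [mul_div_cancel_left₀ _ hx]

theorem fDiv_const_mul (f : ℝ → ℝ) (ν μ : X → ℝ) {c : ℝ} (hc : c ≠ 0) :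
    fDiv f (fun x => c * ν x) (fun x => c * μ x) = c * fDiv f ν μ := by
  rw [fDiv, fDiv, Finset.mul_sum]
  refine Finset.sum_congr rfl fun x _ => ?_
  rw [mul_div_mul_left _ _ hc, mul_assoc]

/-- Data processing inequality along a map. -/
theorem fDiv_push_le (hf : ConvexOn ℝ (Set.Ici 0) f) (π : X → T) {ν μ : X → ℝ}
    (hν : ∀ x, 0 ≤ ν x) (hμ : ∀ x, 0 ≤ μ x) (hac : ∀ x, μ x = 0 → ν x = 0) :
    fDiv f (push π ν) (push π μ) ≤ fDiv f ν μ := by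
  rw [fDiv, fDiv, ← Finset.sum_fiberwise Finset.univ π]
  refine Finset.sum_le_sum fun t _ => ?_
  rcases (push_nonneg hμ t : 0 ≤ push π μ t).eq_or_lt with h0 | hpos
  · rw [← h0, zero_mul]
    have := (Finset.sum_eq_zero_iff_of_nonneg fun x _ => hμ x).1 h0.symm
    exact (Finset.sum_eq_zero fun x hx => by rw [this x hx, zero_mul]).ge
  · have hJ := hf.map_sum_le (t := Finset.univ.filter fun x => π x = t)
      (w := fun x => μ x / push π μ t) (p := fun x => ν x / μ x)
      (fun x _ => div_nonneg (hμ x) hpos.le)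
      (by rw [← Finset.sum_div]; exact div_self hpos.ne')
      (fun x _ => div_nonneg (hν x) (hμ x))
    have h1 : ∑ x with π x = t, (μ x / push π μ t) • (ν x / μ x) = push π ν t / push π μ t := by
      rw [show push π ν t = ∑ x with π x = t, ν x from rfl, Finset.sum_div]
      refine Finset.sum_congr rfl fun x _ => ?_
      by_cases hx : μ x = 0
      · simp [hx, hac x hx]
      · simp only [smul_eq_mul]
        field_simp
    rw [h1] at hJ
    calc push π μ t * f (push π ν t / push π μ t)
        ≤ push π μ t * ∑ x with π x = t, (μ x / push π μ t) • f (ν x / μ x) :=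
          mul_le_mul_of_nonneg_left hJ hpos.le
      _ = _ := by
          rw [Finset.mul_sum]
          refine Finset.sum_congr rfl fun x _ => ?_
          simp only [smul_eq_mul]
          field_simp

/-- A coarser observation has smaller divergence. `Nonempty Z` lets the factor map be extended
beyond the range of `π`. -/
theorem fDiv_push_le_of_factorsThrough [Nonempty Z] (hf : ConvexOn ℝ (Set.Ici 0) f) {π : X → T}
    {σ : X → Z} (hσ : Function.FactorsThrough σ π) {ν μ : X → ℝ}
    (hν : ∀ x, 0 ≤ ν x) (hμ : ∀ x, 0 ≤ μ x) (hac : ∀ x, μ x = 0 → ν x = 0) :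
    fDiv f (push σ ν) (push σ μ) ≤ fDiv f (push π ν) (push π μ) := by
  obtain ⟨τ, rfl⟩ := (Function.factorsThrough_iff σ).1 hσ
  rw [← push_push, ← push_push]
  exact fDiv_push_le hf τ (push_nonneg hν) (push_nonneg hμ)
    fun t => push_eq_zero_of_push_eq_zero hμ hac

/-- The equality case of data processing: a density constant on fibres loses nothing. -/
theorem fDiv_push_mul_comp (f : ℝ → ℝ) (π : X → T) (μ : X → ℝ) (h : T → ℝ) :
    fDiv f (push π fun x => μ x * h (π x)) (push π μ) = fDiv f (fun x => μ x * h (π x)) μ := by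
  rw [fDiv_mul_right f μ fun x => h (π x), funext (push_mul_comp π μ h), fDiv_mul_right,
    sum_push_mul π μ fun t => f (h t)]

theorem fDiv_push_of_injective (f : ℝ → ℝ) {π : X → T}
    (hπ : Function.Injective π) {ν μ : X → ℝ} (hac : ∀ x, μ x = 0 → ν x = 0) :
    fDiv f (push π ν) (push π μ) = fDiv f ν μ := by
  by_cases hX : Nonempty X
  -- Under an injection every density is constant on fibres, so the equality case applies.
  · have h : ν = fun x => μ x *
        (fun t => ν (Function.invFun π t) / μ (Function.invFun π t)) (π x) := by
      funext x
      simp only [Function.leftInverse_invFun hπ x]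
      by_cases hx : μ x = 0
      · simp [hx, hac x hx]
      · rw [mul_div_cancel₀ _ hx]
    rw [h]
    exact fDiv_push_mul_comp f π μ
      fun t => ν (Function.invFun π t) / μ (Function.invFun π t)
  · have := not_nonempty_iff.1 hX
    simp [fDiv, push]

/-- The `f`-divergence splits along mutually singular blocks. -/
theorem fDiv_sum_push {ι : Type*} [Fintype ι] (f : ℝ → ℝ) (π : ι → X → T)
    (hπ : ∀ i j x y, π i x = π j y → i = j) (ν μ : ι → X → ℝ) :
    fDiv f (fun t => ∑ i, push (π i) (ν i) t) (fun t => ∑ i, push (π i) (μ i) t) =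
      ∑ i, fDiv f (push (π i) (ν i)) (push (π i) (μ i)) := by
  simp only [fDiv]
  rw [Finset.sum_comm]
  refine Finset.sum_congr rfl fun t _ => ?_
  by_cases h : ∃ i x, π i x = t
  · obtain ⟨i, x, rfl⟩ := h
    have hz : ∀ (κ : ι → X → ℝ) (j : ι), j ≠ i → push (π j) (κ j) (π i x) = 0 := by
      intro κ j hj
      by_contra hne
      obtain ⟨y, hy⟩ := push_apply_ne_zero hne
      exact hj (hπ _ _ _ _ hy)
    rw [Fintype.sum_eq_single i (hz ν), Fintype.sum_eq_single i (hz μ),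
      Fintype.sum_eq_single i fun j hj => by rw [hz μ j hj, zero_mul]]
  · have hz : ∀ (κ : ι → X → ℝ) (j : ι), push (π j) (κ j) t = 0 := by
      intro κ j
      by_contra hne
      obtain ⟨y, hy⟩ := push_apply_ne_zero hne
      exact h ⟨j, y, hy⟩
    simp [hz μ]

/-- The `f`-entropy `E f (ν / μ) - f (E (ν / μ))` of the density of `ν` for a probability `μ`. -/
def excess (f : ℝ → ℝ) (ν μ : X → ℝ) : ℝ := fDiv f ν μ - f (∑ x, ν x)

theorem excess_nonneg (hf : ConvexOn ℝ (Set.Ici 0) f) {ν μ : X → ℝ} (hν : ∀ x, 0 ≤ ν x)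
    (hμ : μ ∈ stdSimplex ℝ X) (hac : ∀ x, μ x = 0 → ν x = 0) : 0 ≤ excess f ν μ := by
  -- Jensen's inequality is data processing along the map to a point.
  have := fDiv_push_le hf (fun _ : X => ()) hν hμ.1 hac
  simp only [fDiv, push, Finset.univ_unique, Finset.sum_singleton, Finset.filter_true, hμ.2,
    one_mul, div_one] at this
  exact sub_nonneg.2 this

theorem push_mem_stdSimplex (π : X → T) {μ : X → ℝ} (hμ : μ ∈ stdSimplex ℝ X) :
    push π μ ∈ stdSimplex ℝ T :=
  ⟨push_nonneg hμ.1, by rw [sum_push, hμ.2]⟩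

end fDiv

/-! ### Partial assignments and the down operator on them. -/

section slices

variable {n : ℕ} {S : Fin n → Type*}

/-- The partial assignment `{(i, x i) | i ∈ e}`. -/
def res {l : ℕ} (e : Slice (Fin n) l) (x : ∀ i, S i) : Slice (Σ i, S i) l :=
  ⟨e.1.map ⟨fun i => ⟨i, x i⟩, fun _ _ h => congrArg Sigma.fst h⟩, by simpa using e.2⟩

theorem mem_res {l : ℕ} {e : Slice (Fin n) l} {x : ∀ i, S i} {v : Σ i, S i} :
    v ∈ (res e x).1 ↔ v.1 ∈ e.1 ∧ x v.1 = v.2 := by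
  obtain ⟨i, s⟩ := v
  simp only [res, Finset.mem_map]
  constructor
  · rintro ⟨j, hj, h⟩
    cases h
    exact ⟨hj, rfl⟩
  · rintro ⟨hi, rfl⟩
    exact ⟨i, hi, rfl⟩

theorem res_eq_iff {l : ℕ} {e : Slice (Fin n) l} {x y : ∀ i, S i} :
    res e x = res e y ↔ ∀ i ∈ e.1, x i = y i := by
  constructor
  · intro h i hi
    have : (⟨i, x i⟩ : Σ i, S i) ∈ (res e y).1 := h ▸ mem_res.2 ⟨hi, rfl⟩
    exact (mem_res.1 this).2.symm
  · intro h
    refine Subtype.ext (Finset.ext fun v => ?_)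
    rw [mem_res, mem_res]
    exact and_congr_right fun hv => by rw [h _ hv]

theorem eq_of_res_eq {l : ℕ} {e e' : Slice (Fin n) l} {x y : ∀ i, S i}
    (h : res e x = res e' y) : e = e' := by
  refine Subtype.ext (Finset.ext fun i => ⟨fun hi => ?_, fun hi => ?_⟩)
  · have : (⟨i, x i⟩ : Σ i, S i) ∈ (res e' y).1 := h ▸ mem_res.2 ⟨hi, rfl⟩
    exact (mem_res.1 this).1
  · have : (⟨i, y i⟩ : Σ i, S i) ∈ (res e x).1 := h ▸ mem_res.2 ⟨hi, rfl⟩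
    exact (mem_res.1 this).1

theorem res_factorsThrough {k l : ℕ} {e : Slice (Fin n) k} {e' : Slice (Fin n) l}
    (h : e'.1 ⊆ e.1) :
    Function.FactorsThrough (res e' : (∀ i, S i) → _) (res e) := fun _ _ hxy =>
  res_eq_iff.2 fun i hi => res_eq_iff.1 hxy i (h hi)

/-- The full index set as a slice. -/
def fullSlice (n : ℕ) : Slice (Fin n) n := ⟨Finset.univ, by simp⟩

theorem toSlice_injective : Function.Injective (toSlice : (∀ i, S i) → _) := fun _ _ h =>
  funext fun i => res_eq_iff (e := fullSlice n).1 h i (Finset.mem_univ i)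

variable [∀ i, DecidableEq (S i)]

/-- A subset of a partial assignment is the restriction of that assignment to exactly one index set,
namely the set of first components. This turns dropping elements of `Ω` into dropping coordinates.
-/
theorem subset_res_indicator {k l : ℕ} (e : Slice (Fin n) k) (x : ∀ i, S i)
    (B : Slice (Σ i, S i) l) :
    (if B.1 ⊆ (res e x).1 then (1 : ℝ) else 0) =
      ∑ e' : Slice (Fin n) l with e'.1 ⊆ e.1, if res e' x = B then 1 else 0 := by
  split_ifs with h
  · have hinj : Set.InjOn Sigma.fst (B.1 : Set (Σ i, S i)) := by
      rintro ⟨i, s⟩ hv ⟨j, t⟩ hw (rfl : i = j)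
      have h1 := (mem_res.1 (h hv)).2
      have h2 := (mem_res.1 (h hw)).2
      simp only at h1 h2
      rw [← h1, ← h2]
    let e₀ : Slice (Fin n) l := ⟨B.1.image Sigma.fst, by rw [Finset.card_image_of_injOn hinj, B.2]⟩
    have he₀ : e₀.1 ⊆ e.1 := by
      intro i hi
      obtain ⟨v, hv, rfl⟩ := Finset.mem_image.1 hi
      exact (mem_res.1 (h hv)).1
    have hres : res e₀ x = B := by
      refine Subtype.ext (Finset.eq_of_subset_of_card_le ?_ (by rw [B.2, (res e₀ x).2])).symm
      intro v hv
      exact mem_res.2 ⟨Finset.mem_image_of_mem _ hv, (mem_res.1 (h hv)).2⟩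
    rw [Finset.sum_eq_single_of_mem e₀ (by simpa using he₀)]
    · rw [if_pos hres]
    · intro e' _ hne
      rw [if_neg]
      exact fun h' => hne (eq_of_res_eq (h'.trans hres.symm))
  · refine (Finset.sum_eq_zero fun e' he' => if_neg ?_).symm
    rintro rfl
    refine h fun v hv => ?_
    rw [mem_res] at hv ⊢
    exact ⟨(Finset.mem_filter.1 he').2 hv.1, hv.2⟩

variable [∀ i, Fintype (S i)]

theorem push_res_vecMul_down {k l : ℕ} (e : Slice (Fin n) k) (N : (∀ i, S i) → ℝ)
    (B : Slice (Σ i, S i) l) :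
    (push (res e) N ᵥ* down (Σ i, S i) k l) B =
      1 / (k.choose l : ℝ) * ∑ e' : Slice (Fin n) l with e'.1 ⊆ e.1, push (res e') N B := by
  have h := sum_push_mul (res e) N fun A => down (Σ i, S i) k l A B
  rw [show (push (res e) N ᵥ* down (Σ i, S i) k l) B =
    ∑ A, push (res e) N A * down (Σ i, S i) k l A B from rfl, h]
  have h2 : ∀ x, down (Σ i, S i) k l (res e x) B =
      1 / (k.choose l : ℝ) *
        ∑ e' : Slice (Fin n) l with e'.1 ⊆ e.1, if res e' x = B then 1 else 0 := by
    intro x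
    rw [← subset_res_indicator]
    simp [down]
  simp only [h2, push, Finset.sum_filter (fun x => res _ x = B), Finset.mul_sum]
  rw [Finset.sum_comm]
  refine Finset.sum_congr rfl fun e' _ => Finset.sum_congr rfl fun x _ => ?_
  split_ifs <;> ring

theorem marginal_hom {l : ℕ} (μ : (∀ i, S i) → ℝ) (B : Slice (Σ i, S i) l) :
    marginal l (hom μ) B = 1 / (n.choose l : ℝ) * ∑ e : Slice (Fin n) l, push (res e) μ B := by
  have := push_res_vecMul_down (l := l) (fullSlice n) μ B
  rwa [Finset.filter_true_of_mem fun e _ => show e.1 ⊆ (fullSlice n).1 from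
    Finset.subset_univ _] at this

/-- The divergence after a down step from the top level, by blocks. -/
theorem fDiv_hom_vecMul_down {l : ℕ} (hl : l ≤ n) (f : ℝ → ℝ) (ν μ : (∀ i, S i) → ℝ) :
    fDiv f (hom ν ᵥ* down (Σ i, S i) n l) (hom μ ᵥ* down (Σ i, S i) n l) =
      1 / (n.choose l : ℝ) * ∑ e : Slice (Fin n) l, fDiv f (push (res e) ν) (push (res e) μ) := by
  rw [← fDiv_sum_push f (fun e : Slice (Fin n) l => res e)
    (fun _ _ _ _ h => eq_of_res_eq h) (fun _ => ν) (fun _ => μ),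
    ← fDiv_const_mul _ _ _ (by have := Nat.choose_pos hl; positivity)]
  congr 1
  · exact funext (marginal_hom ν)
  · exact funext (marginal_hom μ)

end slices

/-! ### Double counting on the complete graph. -/

section counting

variable {α : Type*}

/-- The singleton `{i}` as a slice. -/
def single (i : α) : Slice α 1 := ⟨{i}, Finset.card_singleton i⟩

theorem single_bijective : Function.Bijective (single : α → Slice α 1) := by
  refine ⟨fun i j h => Finset.singleton_injective (congrArg Subtype.val h), fun v => ?_⟩
  obtain ⟨i, hi⟩ := Finset.card_eq_one.1 v.2
  exact ⟨i, Subtype.ext hi.symm⟩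

theorem single_subset {i : α} {s : Finset α} : (single i).1 ⊆ s ↔ i ∈ s :=
  Finset.singleton_subset_iff

variable [Fintype α]

theorem sum_slice_one (F : Slice α 1 → ℝ) : ∑ v, F v = ∑ i, F (single i) :=
  (Function.Bijective.sum_comp single_bijective F).symm

variable [DecidableEq α]

theorem sum_slice_one_subset (e : Finset α) (F : Slice α 1 → ℝ) :
    ∑ v : Slice α 1 with v.1 ⊆ e, F v = ∑ i ∈ e, F (single i) := by
  rw [Finset.sum_filter, sum_slice_one, ← Finset.sum_filter]
  simp only [single_subset, Finset.filter_univ_mem]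

/-- Each edge comes from exactly two ordered pairs. -/
theorem sum_offDiag (F : Finset α → ℝ) :
    ∑ p ∈ (Finset.univ : Finset α).offDiag, F {p.1, p.2} = 2 * ∑ e : Slice α 2, F e.1 := by
  have h1 : ∀ p ∈ (Finset.univ : Finset α).offDiag,
      ({p.1, p.2} : Finset α) ∈ Finset.powersetCard 2 (Finset.univ : Finset α) := by
    intro p hp
    simpa using Finset.card_pair (Finset.mem_offDiag.1 hp).2.2
  have h2 : ∑ e : Slice α 2, F e.1 = ∑ e ∈ Finset.powersetCard 2 (Finset.univ : Finset α), F e :=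
    (Finset.sum_subtype _ (by simp) F).symm
  rw [← Finset.sum_fiberwise_of_maps_to h1, h2, Finset.mul_sum]
  refine Finset.sum_congr rfl fun e he => ?_
  have hcard : e.card = 2 := (Finset.mem_powersetCard.1 he).2
  rw [Finset.sum_congr rfl fun p hp => by rw [(Finset.mem_filter.1 hp).2], Finset.sum_const,
    nsmul_eq_mul]
  congr 1
  have : ((Finset.univ : Finset α).offDiag.filter fun p => ({p.1, p.2} : Finset α) = e) =
      e.offDiag := by
    ext ⟨a, b⟩
    simp only [Finset.mem_filter, Finset.mem_offDiag, Finset.mem_univ, true_and]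
    constructor
    · rintro ⟨hab, rfl⟩
      simp [hab]
    · rintro ⟨ha, hb, hab⟩
      refine ⟨hab, Finset.eq_of_subset_of_card_le ?_ (by rw [Finset.card_pair hab, hcard])⟩
      intro c hc
      rcases Finset.mem_insert.1 hc with rfl | hc
      · exact ha
      · exact Finset.mem_singleton.1 hc ▸ hb
  rw [this, Finset.offDiag_card, hcard]
  norm_num

theorem sum_sum_offDiag (G : α → α → ℝ) :
    ∑ p ∈ (Finset.univ : Finset α).offDiag, G p.1 p.2 = ∑ i, ∑ j, G i j - ∑ i, G i i := by
  have h := Finset.sum_union (f := fun p : α × α => G p.1 p.2)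
    (Finset.disjoint_diag_offDiag (Finset.univ : Finset α))
  rw [Finset.diag_union_offDiag, Finset.sum_product, Finset.sum_diag] at h
  linarith

theorem sum_edges_sum (F : Slice α 2 → ℝ) (G : α → ℝ) :
    ∑ e : Slice α 2, F e * ∑ i ∈ e.1, G i = ∑ i, G i * ∑ e : Slice α 2 with i ∈ e.1, F e := by
  simp only [Finset.mul_sum, Finset.sum_filter]
  rw [Finset.sum_comm]
  refine Finset.sum_congr rfl fun e _ => ?_
  simp only [mul_ite, mul_zero]
  rw [← Finset.sum_filter, Finset.filter_univ_mem]
  exact Finset.sum_congr rfl fun i _ => mul_comm _ _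

theorem card_edges_at (i : α) :
    ((Finset.univ.filter fun e : Slice α 2 => i ∈ e.1).card : ℝ) = Fintype.card α - 1 := by
  have h := sum_offDiag (fun s : Finset α => if i ∈ s then (1 : ℝ) else 0)
  have h2 : ∀ a b : α, a ≠ b → (if i ∈ ({a, b} : Finset α) then (1 : ℝ) else 0) =
      (if a = i then 1 else 0) + if b = i then 1 else 0 := by
    intro a b hab
    simp only [Finset.mem_insert, Finset.mem_singleton, eq_comm (a := i)]
    by_cases ha : a = i <;> by_cases hb : b = i <;> simp [ha, hb]
    exact hab (ha.trans hb.symm)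
  rw [Finset.sum_congr rfl fun p hp => h2 p.1 p.2 (Finset.mem_offDiag.1 hp).2.2,
    sum_sum_offDiag fun a b => (if a = i then (1 : ℝ) else 0) + if b = i then 1 else 0] at h
  simp [Finset.sum_add_distrib] at h
  linarith

theorem card_slice_two : (Fintype.card (Slice α 2) : ℝ) =
    Fintype.card α * (Fintype.card α - 1) / 2 := by
  have h := sum_offDiag (fun _ : Finset α => (1 : ℝ))
  rw [sum_sum_offDiag fun _ _ => (1 : ℝ)] at h
  simp at h ⊢
  linarith

/-- The slice of all indices but one. -/
def coSingle {n : ℕ} (k : Fin n) : Slice (Fin n) (n - 1) :=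
  ⟨Finset.univ.erase k, by simp⟩

theorem coSingle_bijective {n : ℕ} (hn : 1 ≤ n) :
    Function.Bijective (coSingle : Fin n → Slice (Fin n) (n - 1)) := by
  constructor
  · intro i j h
    have h1 : i ∉ (coSingle j).1 := h ▸ Finset.notMem_erase _ _
    simpa [coSingle] using h1
  · intro g
    have : (g.1ᶜ).card = 1 := by
      rw [Finset.card_compl, g.2, Fintype.card_fin]
      omega
    obtain ⟨k, hk⟩ := Finset.card_eq_one.1 this
    refine ⟨k, Subtype.ext ?_⟩
    rw [← compl_compl g.1, hk, Finset.compl_singleton]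
    rfl

end counting

/-! ### What is required of `f`. -/

/-- The properties of the generator of an `f`-divergence that the local-to-global comparison
uses. -/
structure IsEntropy.{u} (f : ℝ → ℝ) : Prop where
  convexOn : ConvexOn ℝ (Set.Ici 0) f
  one : f 1 = 0
  -- The linear term vanishes on summing over values of mean one, so such sums of `f` are
  -- nonnegative.
  tangent : ∃ d : ℝ, ∀ t, 0 ≤ t → d * (t - 1) ≤ f t
  -- Makes `excess` homogeneous up to a positive factor, so that blocks of any positive mass reduce
  -- to probability distributions.
  scaling : ∀ c : ℝ, 0 < c → ∃ κ : ℝ, 0 < κ ∧ ∃ p q : ℝ, ∀ t, 0 ≤ t →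
    f (c * t) = κ * f t + p * t + q
  excess_convexOn : ∀ {T : Type u} [Fintype T] (μ : T → ℝ), μ ∈ stdSimplex ℝ T →
    ConvexOn ℝ {ν : T → ℝ | (∀ x, 0 ≤ ν x) ∧ ∀ x, μ x = 0 → ν x = 0} fun ν => excess f ν μ
  edge : ∀ {n : ℕ}, 2 ≤ n → ∀ a : Slice (Fin n) 2 → ℝ, (∀ e, 0 ≤ a e) →
    ∑ e, a e = Fintype.card (Slice (Fin n) 2) →
    ((n : ℝ) - 1) * ∑ i, f ((∑ e : Slice (Fin n) 2 with i ∈ e.1, a e) / (n - 1)) ≤ ∑ e, f (a e)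

theorem convex_dominated {T : Type*} (μ : T → ℝ) :
    Convex ℝ {ν : T → ℝ | (∀ x, 0 ≤ ν x) ∧ ∀ x, μ x = 0 → ν x = 0} := by
  rintro ν ⟨h1, h2⟩ ν' ⟨h1', h2'⟩ a b ha hb -
  refine ⟨fun x => ?_, fun x hx => ?_⟩
  · have := h1 x
    have := h1' x
    simp only [Pi.add_apply, Pi.smul_apply, smul_eq_mul]
    positivity
  · simp [h2 x hx, h2' x hx]

/-! ### Convexity of the χ² entropy. -/

section chiSq

theorem excess_chiSq {T : Type*} [Fintype T] {ν μ : T → ℝ} (hμ : μ ∈ stdSimplex ℝ T)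
    (hac : ∀ x, μ x = 0 → ν x = 0) :
    excess chiSq ν μ = ∑ x, ν x ^ 2 / μ x - (∑ x, ν x) ^ 2 := by
  have h : ∀ x, μ x * chiSq (ν x / μ x) = ν x ^ 2 / μ x - 2 * ν x + μ x := by
    intro x
    by_cases hx : μ x = 0
    · simp [hx, hac x hx]
    · rw [chiSq]
      field_simp
      ring
  rw [excess, fDiv, Finset.sum_congr rfl fun x _ => h x, Finset.sum_add_distrib,
    Finset.sum_sub_distrib, hμ.2, ← Finset.mul_sum, chiSq]
  ring

/-- Cauchy–Schwarz. No sign is imposed on `ν`, since it is applied to a difference of two measures.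
-/
theorem sq_sum_le_sum_sq_div {T : Type*} [Fintype T] {ν μ : T → ℝ} (hμ : μ ∈ stdSimplex ℝ T)
    (hac : ∀ x, μ x = 0 → ν x = 0) : (∑ x, ν x) ^ 2 ≤ ∑ x, ν x ^ 2 / μ x := by
  have := Finset.sum_sq_le_sum_mul_sum_of_sq_le_mul Finset.univ (r := ν) (f := μ)
    (g := fun x => ν x ^ 2 / μ x) (fun x _ => hμ.1 x)
    (fun x _ => div_nonneg (sq_nonneg _) (hμ.1 x)) fun x _ => by
      by_cases hx : μ x = 0
      · simp [hx, hac x hx]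
      · exact (mul_div_cancel₀ _ hx).ge
  rwa [hμ.2, one_mul] at this

theorem excess_chiSq_convexOn {T : Type*} [Fintype T] (μ : T → ℝ) (hμ : μ ∈ stdSimplex ℝ T) :
    ConvexOn ℝ {ν : T → ℝ | (∀ x, 0 ≤ ν x) ∧ ∀ x, μ x = 0 → ν x = 0}
      fun ν => excess chiSq ν μ := by
  refine ⟨convex_dominated μ, ?_⟩
  rintro ν hν ν' hν' a b ha hb hab
  have h3 := (convex_dominated μ hν hν' ha hb hab).2
  change excess chiSq _ μ ≤ a * excess chiSq ν μ + b * excess chiSq ν' μ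
  rw [excess_chiSq hμ h3, excess_chiSq hμ hν.2, excess_chiSq hμ hν'.2]
  -- The entropy is a quadratic form, and its convexity defect is `a * (1 - a)` times the form at `ν
  -- - ν'`.
  have hq := sq_sum_le_sum_sq_div (ν := fun x => ν x - ν' x) hμ
    fun x hx => by rw [hν.2 x hx, hν'.2 x hx, sub_zero]
  obtain rfl : b = 1 - a := by linarith
  have h4 : ∀ x, (a • ν + (1 - a) • ν') x ^ 2 / μ x = a * (ν x ^ 2 / μ x) +
      (1 - a) * (ν' x ^ 2 / μ x) - a * (1 - a) * ((ν x - ν' x) ^ 2 / μ x) := by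
    intro x
    simp only [Pi.add_apply, Pi.smul_apply, smul_eq_mul]
    ring
  rw [Finset.sum_congr rfl fun x _ => h4 x]
  simp only [Pi.add_apply, Pi.smul_apply, smul_eq_mul, Finset.sum_sub_distrib,
    Finset.sum_add_distrib, ← Finset.mul_sum] at hq ⊢
  nlinarith [mul_le_mul_of_nonneg_left hq (mul_nonneg ha hb)]

end chiSq

/-! ### Convexity of the KL entropy. -/

section kl

theorem log_tangent {y z : ℝ} (hy : 0 ≤ y) (hz : 0 ≤ z) (h : z = 0 → y = 0) :
    y - z ≤ y * Real.log y - y * Real.log z := by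
  rcases hy.eq_or_lt with rfl | hy
  · simpa using hz
  · have hz : 0 < z := hz.lt_of_ne fun h0 => hy.ne' (h h0.symm)
    have := Real.one_sub_inv_le_log_of_pos (div_pos hy hz)
    rw [Real.log_div hy.ne' hz.ne', inv_div] at this
    have h2 := mul_le_mul_of_nonneg_left this hy.le
    have h3 : y * (1 - z / y) = y - z := by field_simp
    linarith

theorem excess_kl {T : Type*} [Fintype T] {ν μ : T → ℝ} (hac : ∀ x, μ x = 0 → ν x = 0) :
    excess kl ν μ = ∑ x, ν x * (Real.log (ν x / μ x) - Real.log (∑ y, ν y)) := by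
  have h : ∀ x, μ x * kl (ν x / μ x) = ν x * Real.log (ν x / μ x) := by
    intro x
    by_cases hx : μ x = 0
    · simp [hx, hac x hx]
    · rw [kl]
      field_simp
  simp only [mul_sub]
  rw [excess, fDiv, Finset.sum_congr rfl fun x _ => h x, Finset.sum_sub_distrib,
    ← Finset.sum_mul, kl]

/-- The left side is linear in `ν` and equals the entropy at `ν = ν₀`: it is a supporting
functional. The pointwise gap is `log_tangent` against `ν₀` rescaled to the mass of `ν`, and the
error terms sum to zero. -/
theorem excess_kl_ge {T : Type*} [Fintype T] {ν ν₀ μ : T → ℝ}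
    (hac : ∀ x, μ x = 0 → ν x = 0) (hν : ∀ x, 0 ≤ ν x) (hν₀ : ∀ x, 0 ≤ ν₀ x)
    (h₀ : ∀ x, ν₀ x = 0 → ν x = 0) :
    ∑ x, ν x * (Real.log (ν₀ x / μ x) - Real.log (∑ y, ν₀ y)) ≤ excess kl ν μ := by
  rw [excess_kl hac]
  set N := ∑ y, ν y
  set N₀ := ∑ y, ν₀ y
  by_cases hN₀ : N₀ = 0
  · have h1 := (Finset.sum_eq_zero_iff_of_nonneg fun x _ => hν₀ x).1 hN₀
    have h2 : ∀ x, ν x = 0 := fun x => h₀ x (h1 x (Finset.mem_univ x))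
    simp [h2]
  have hpt : ∀ x, ν x - ν₀ x * N / N₀ ≤ ν x * (Real.log (ν x / μ x) - Real.log N) -
      ν x * (Real.log (ν₀ x / μ x) - Real.log N₀) := by
    intro x
    have hN : 0 ≤ N := Finset.sum_nonneg fun y _ => hν y
    have hN₀' : 0 ≤ N₀ := Finset.sum_nonneg fun y _ => hν₀ y
    rcases (hν x).eq_or_lt with hx | hx
    · rw [← hx]
      have : 0 ≤ ν₀ x * N / N₀ := div_nonneg (mul_nonneg (hν₀ x) hN) hN₀'
      simpa using this
    · have hμx : μ x ≠ 0 := fun h => hx.ne' (hac x h)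
      have hν₀x : ν₀ x ≠ 0 := fun h => hx.ne' (h₀ x h)
      have hNx : N ≠ 0 :=
        (hx.trans_le (Finset.single_le_sum (fun y _ => hν y) (Finset.mem_univ x))).ne'
      have := log_tangent hx.le (z := ν₀ x * N / N₀)
        (div_nonneg (mul_nonneg (hν₀ x) hN) hN₀') fun h => absurd h (by positivity)
      rw [Real.log_div (mul_ne_zero hν₀x hNx) hN₀, Real.log_mul hν₀x hNx] at this
      rw [Real.log_div hx.ne' hμx, Real.log_div hν₀x hμx]
      linarith
  have hsum := Finset.sum_le_sum fun x (_ : x ∈ Finset.univ) => hpt x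
  rw [Finset.sum_sub_distrib, Finset.sum_sub_distrib, ← Finset.sum_div, ← Finset.sum_mul,
    show ∑ i, ν₀ i = N₀ from rfl, mul_div_cancel_left₀ _ hN₀, sub_self] at hsum
  linarith

theorem excess_kl_convexOn {T : Type*} [Fintype T] (μ : T → ℝ) :
    ConvexOn ℝ {ν : T → ℝ | (∀ x, 0 ≤ ν x) ∧ ∀ x, μ x = 0 → ν x = 0}
      fun ν => excess kl ν μ := by
  -- Both functions are compared with the supporting functional at their combination. Positive
  -- weights make the combination's support contain both supports.
  refine convexOn_iff_forall_pos.2 ⟨convex_dominated μ, ?_⟩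
  rintro ν hν ν' hν' a b ha hb hab
  have h3 := convex_dominated μ hν hν' ha.le hb.le hab
  have hz : ∀ x, (a • ν + b • ν') x = 0 → ν x = 0 ∧ ν' x = 0 := by
    intro x hx
    simp only [Pi.add_apply, Pi.smul_apply, smul_eq_mul] at hx
    have h1 := mul_nonneg ha.le (hν.1 x)
    have h2 := mul_nonneg hb.le (hν'.1 x)
    constructor
    · exact (mul_eq_zero.1 (by linarith : a * ν x = 0)).resolve_left ha.ne'
    · exact (mul_eq_zero.1 (by linarith : b * ν' x = 0)).resolve_left hb.ne'
  have h1 := excess_kl_ge hν.2 hν.1 h3.1 fun x hx => (hz x hx).1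
  have h2 := excess_kl_ge hν'.2 hν'.1 h3.1 fun x hx => (hz x hx).2
  change excess kl _ μ ≤ a * excess kl ν μ + b * excess kl ν' μ
  rw [excess_kl h3.2]
  refine le_trans (le_of_eq ?_) (add_le_add (mul_le_mul_of_nonneg_left h1 ha.le)
    (mul_le_mul_of_nonneg_left h2 hb.le))
  rw [Finset.mul_sum, Finset.mul_sum, ← Finset.sum_add_distrib]
  refine Finset.sum_congr rfl fun x _ => ?_
  rw [show (a • ν + b • ν') x = a * ν x + b * ν' x from rfl]
  ring

end kl

/-! ### The contraction by one half on the complete graph. -/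

section edge

variable {n : ℕ} (a : Slice (Fin n) 2 → ℝ)

/-- The average weight of the edges at a vertex. -/
def vertexAvg (i : Fin n) : ℝ := (∑ e : Slice (Fin n) 2 with i ∈ e.1, a e) / (n - 1)

theorem sum_mul_vertexAvg (hn : 2 ≤ n) (G : Fin n → ℝ) :
    ∑ e, a e * ∑ i ∈ e.1, G i = (n - 1) * ∑ i, G i * vertexAvg a i := by
  have : (2 : ℝ) ≤ n := by exact_mod_cast hn
  rw [sum_edges_sum, Finset.mul_sum]
  refine Finset.sum_congr rfl fun i _ => ?_
  rw [vertexAvg]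
  have : (n : ℝ) - 1 ≠ 0 := by linarith
  field_simp

theorem sum_edges_sum' (G : Fin n → ℝ) :
    ∑ e : Slice (Fin n) 2, ∑ i ∈ e.1, G i = (n - 1) * ∑ i, G i := by
  have := sum_edges_sum (fun _ : Slice (Fin n) 2 => (1 : ℝ)) G
  simp only [one_mul, Finset.sum_const, nsmul_eq_mul, mul_one, card_edges_at,
    Fintype.card_fin] at this
  rw [this, ← Finset.sum_mul, mul_comm]

theorem sum_vertexAvg (hn : 2 ≤ n) (ha : ∑ e, a e = Fintype.card (Slice (Fin n) 2)) :
    ∑ i, vertexAvg a i = n := by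
  have h2 : (2 : ℝ) ≤ n := by exact_mod_cast hn
  have h := sum_mul_vertexAvg a hn fun _ => 1
  have hc : ∀ e : Slice (Fin n) 2, a e * ∑ i ∈ e.1, (1 : ℝ) = 2 * a e := by
    intro e
    simp [e.2, mul_comm]
  rw [Finset.sum_congr rfl fun e _ => hc e, ← Finset.mul_sum, ha, card_slice_two,
    Fintype.card_fin] at h
  simp only [one_mul] at h
  have : (n : ℝ) - 1 ≠ 0 := by linarith
  exact mul_left_cancel₀ this (by linarith)

theorem sum_edges_prod (b : Fin n → ℝ) :
    2 * ∑ e : Slice (Fin n) 2, ∏ i ∈ e.1, b i = (∑ i, b i) ^ 2 - ∑ i, b i ^ 2 := by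
  rw [← sum_offDiag fun s => ∏ i ∈ s, b i,
    Finset.sum_congr rfl fun p hp => Finset.prod_pair (Finset.mem_offDiag.1 hp).2.2,
    sum_sum_offDiag fun i j => b i * b j, sq, Finset.sum_mul_sum]
  simp only [sq]

theorem sum_edges_sq (b : Fin n → ℝ) :
    ∑ e : Slice (Fin n) 2, (∑ i ∈ e.1, b i) ^ 2 = (n - 2) * ∑ i, b i ^ 2 + (∑ i, b i) ^ 2 := by
  have h : ∀ e : Slice (Fin n) 2,
      (∑ i ∈ e.1, b i) ^ 2 = ∑ i ∈ e.1, b i ^ 2 + 2 * ∏ i ∈ e.1, b i := by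
    intro e
    obtain ⟨i, j, hij, he⟩ := Finset.card_eq_two.1 e.2
    rw [he, Finset.sum_pair hij, Finset.sum_pair hij, Finset.prod_pair hij]
    ring
  rw [Finset.sum_congr rfl fun e _ => h e, Finset.sum_add_distrib, sum_edges_sum',
    ← Finset.mul_sum, sum_edges_prod]
  ring

theorem chiSq_edge (hn : 2 ≤ n) (ha : ∑ e, a e = Fintype.card (Slice (Fin n) 2)) :
    ((n : ℝ) - 1) * ∑ i, chiSq (vertexAvg a i) ≤ ∑ e, chiSq (a e) := by
  have hb := sum_vertexAvg a hn ha
  set β : Fin n → ℝ := fun i => vertexAvg a i - 1 with hβ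
  have hβ0 : ∑ i, β i = 0 := by
    simp [hβ, Finset.sum_sub_distrib, hb]
  -- Expanding a square compares `a e - 1` with the sum of `β` over the endpoints. Summed over
  -- edges, the lower bound is `n * ∑ i, β i ^ 2`, slightly more than needed.
  have h1 : ∀ e, 2 * (a e * ∑ i ∈ e.1, β i) - 2 * ∑ i ∈ e.1, β i - (∑ i ∈ e.1, β i) ^ 2 ≤
      chiSq (a e) := by
    intro e
    rw [chiSq]
    nlinarith [sq_nonneg (a e - 1 - ∑ i ∈ e.1, β i)]
  have h2 := Finset.sum_le_sum fun e (_ : e ∈ Finset.univ) => h1 e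
  simp only [Finset.sum_sub_distrib, ← Finset.mul_sum] at h2
  rw [sum_mul_vertexAvg a hn, sum_edges_sum', sum_edges_sq, hβ0] at h2
  have h3 : ∑ i, β i * vertexAvg a i = ∑ i, β i ^ 2 := by
    have : ∀ i, β i * vertexAvg a i = β i ^ 2 + β i := fun i => by
      simp only [hβ]
      ring
    rw [Finset.sum_congr rfl fun i _ => this i, Finset.sum_add_distrib, hβ0, add_zero]
  have h4 : ∑ i, chiSq (vertexAvg a i) = ∑ i, β i ^ 2 := rfl
  rw [h3] at h2
  rw [h4]
  have : 0 ≤ ∑ i, β i ^ 2 := Finset.sum_nonneg fun i _ => sq_nonneg _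
  linarith

theorem kl_edge (hn : 2 ≤ n) (ha0 : ∀ e, 0 ≤ a e)
    (ha : ∑ e, a e = Fintype.card (Slice (Fin n) 2)) :
    ((n : ℝ) - 1) * ∑ i, kl (vertexAvg a i) ≤ ∑ e, kl (a e) := by
  have hn2 : (2 : ℝ) ≤ n := by exact_mod_cast hn
  have hb := sum_vertexAvg a hn ha
  have hb0 : ∀ i, 0 ≤ vertexAvg a i := fun i =>
    div_nonneg (Finset.sum_nonneg fun e _ => ha0 e) (by linarith)
  have hbz : ∀ e : Slice (Fin n) 2, ∀ i ∈ e.1, vertexAvg a i = 0 → a e = 0 := by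
    intro e i hi h
    rw [vertexAvg, div_eq_zero_iff, or_iff_left (by linarith),
      Finset.sum_eq_zero_iff_of_nonneg fun e _ => ha0 e] at h
    exact h e (by simpa using hi)
  -- The comparison measure is the product of the two vertex averages. Its total mass is at most
  -- that of `a`, because averages with mean one have squares summing to at least `n`.
  have h1 : ∀ e, a e - ∏ i ∈ e.1, vertexAvg a i ≤
      kl (a e) - a e * ∑ i ∈ e.1, Real.log (vertexAvg a i) := by
    intro e
    have hz : ∏ i ∈ e.1, vertexAvg a i = 0 → a e = 0 := fun h => by
      obtain ⟨i, hi, h⟩ := Finset.prod_eq_zero_iff.1 h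
      exact hbz e i hi h
    refine (log_tangent (ha0 e) (Finset.prod_nonneg fun i _ => hb0 i) hz).trans (le_of_eq ?_)
    by_cases h : a e = 0
    · simp [h, kl]
    · rw [Real.log_prod fun i hi h' => h (hbz e i hi h'), kl]
  have h2 := Finset.sum_le_sum fun e (_ : e ∈ Finset.univ) => h1 e
  simp only [Finset.sum_sub_distrib] at h2
  rw [sum_mul_vertexAvg a hn, ha, card_slice_two, Fintype.card_fin] at h2
  have h3 := sum_edges_prod (vertexAvg a)
  rw [hb] at h3
  have h4 : (n : ℝ) ^ 2 ≤ n * ∑ i, vertexAvg a i ^ 2 := by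
    have := sq_sum_le_card_mul_sum_sq (s := Finset.univ) (f := vertexAvg a)
    rwa [hb, Finset.card_univ, Fintype.card_fin] at this
  have h5 : (n : ℝ) ≤ ∑ i, vertexAvg a i ^ 2 := by
    rw [sq] at h4
    exact le_of_mul_le_mul_left h4 (by linarith)
  have h6 : ∑ i, Real.log (vertexAvg a i) * vertexAvg a i = ∑ i, kl (vertexAvg a i) :=
    Finset.sum_congr rfl fun i _ => mul_comm _ _
  rw [h6] at h2
  nlinarith

end edge

/-! ### The two generators, and rescaling of entropy. -/

theorem isEntropy_chiSq : IsEntropy chiSq where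
  convexOn := by
    have : ConvexOn ℝ Set.univ (fun t : ℝ => (t - 1) ^ 2) := by
      have h := (even_two.convexOn_pow (𝕜 := ℝ)).translate_left (-1)
      simpa [Function.comp_def, sub_eq_add_neg] using h
    exact this.subset (Set.subset_univ _) (convex_Ici 0)
  one := by simp [chiSq]
  tangent := ⟨0, fun t _ => by rw [zero_mul, chiSq]; positivity⟩
  scaling c hc := ⟨c ^ 2, by positivity, 2 * c ^ 2 - 2 * c, 1 - c ^ 2, fun t _ => by
    simp only [chiSq]
    ring⟩
  excess_convexOn := excess_chiSq_convexOn
  edge hn a _ ha := chiSq_edge a hn ha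

theorem isEntropy_kl : IsEntropy kl where
  convexOn := Real.convexOn_mul_log
  one := by simp [kl]
  tangent := ⟨1, fun t ht => by
    have := log_tangent ht zero_le_one (by simp)
    rw [kl]
    simpa using this⟩
  scaling c hc := ⟨c, hc, c * Real.log c, 0, fun t ht => by
    rcases ht.eq_or_lt with rfl | ht
    · simp [kl]
    · rw [kl, kl, Real.log_mul hc.ne' ht.ne']
      ring⟩
  excess_convexOn μ _ := excess_kl_convexOn μ
  edge hn a ha0 ha := kl_edge a hn ha0 ha

theorem sum_mul_div {T : Type*} [Fintype T] {ν μ : T → ℝ} (hac : ∀ x, μ x = 0 → ν x = 0) :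
    ∑ x, μ x * (ν x / μ x) = ∑ x, ν x := by
  refine Finset.sum_congr rfl fun x _ => ?_
  by_cases hx : μ x = 0
  · simp [hx, hac x hx]
  · rw [mul_div_cancel₀ _ hx]

theorem excess_const_mul {T : Type*} [Fintype T] {f : ℝ → ℝ} {c κ p q : ℝ}
    (hf : ∀ t, 0 ≤ t → f (c * t) = κ * f t + p * t + q) {ν μ : T → ℝ}
    (hμ : μ ∈ stdSimplex ℝ T) (hν : ∀ x, 0 ≤ ν x) (hac : ∀ x, μ x = 0 → ν x = 0) :
    excess f (fun x => c * ν x) μ = κ * excess f ν μ := by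
  have h : ∀ x, μ x * f (c * ν x / μ x) =
      κ * (μ x * f (ν x / μ x)) + p * (μ x * (ν x / μ x)) + q * μ x := by
    intro x
    rw [mul_div_assoc, hf _ (div_nonneg (hν x) (hμ.1 x))]
    ring
  -- The affine terms of `hf` contribute equally to the divergence and to the value at the mean, and
  -- cancel.
  rw [excess, excess, fDiv, fDiv, Finset.sum_congr rfl fun x _ => h x, Finset.sum_add_distrib,
    Finset.sum_add_distrib, ← Finset.mul_sum, ← Finset.mul_sum, ← Finset.mul_sum, sum_mul_div hac,
    hμ.2, ← Finset.mul_sum, hf _ (Finset.sum_nonneg fun x _ => hν x)]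
  ring

theorem excess_zero {T : Type*} [Fintype T] {f : ℝ → ℝ} {μ : T → ℝ}
    (hμ : μ ∈ stdSimplex ℝ T) : excess f (fun _ => 0) μ = 0 := by
  simp [excess, fDiv, ← Finset.sum_mul, hμ.2]

/-! ### Approximate tensorization for pairs of coordinates. -/

section tensorization

variable {n : ℕ} {S : Fin n → Type*} [∀ i, Fintype (S i)] [∀ i, DecidableEq (S i)]
  {μ : (∀ i, S i) → ℝ} {f : ℝ → ℝ} {C : ℝ}

/-- The hypothesis read on the product space: homogenization is injective, and the down step deletes
a uniformly random coordinate. -/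
theorem sum_fDiv_coSingle_le (hn : 2 ≤ n) (hμ : μ ∈ stdSimplex ℝ (∀ i, S i))
    (hc : Contracts f (1 - 1 / (C * n)) (down (Σ i, S i) n (n - 1)) (hom μ))
    {ν : (∀ i, S i) → ℝ} (hν : ν ∈ stdSimplex ℝ (∀ i, S i)) (hac : ∀ x, μ x = 0 → ν x = 0) :
    ∑ k, fDiv f (push (res (coSingle k)) ν) (push (res (coSingle k)) μ) ≤
      (n - 1 / C) * fDiv f ν μ := by
  have h := hc (hom ν) (push_mem_stdSimplex toSlice hν)
    fun A => push_eq_zero_of_push_eq_zero (π := toSlice) hμ.1 hac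
  rw [fDiv_hom_vecMul_down (Nat.sub_le n 1),
    show fDiv f (hom ν) (hom μ) = fDiv f ν μ from
      fDiv_push_of_injective f toSlice_injective hac,
    Nat.choose_symm (by omega : 1 ≤ n), Nat.choose_one_right,
    ← (coSingle_bijective (by omega)).sum_comp] at h
  have hn0 : (0 : ℝ) < n := by exact_mod_cast (by omega : 0 < n)
  have h2 := mul_le_mul_of_nonneg_left h hn0.le
  rw [← mul_assoc, mul_one_div_cancel hn0.ne', one_mul, ← mul_assoc] at h2
  refine h2.trans (le_of_eq ?_)
  congr 1
  field_simp

/-- Approximate tensorization passes to the marginal of a pair of coordinates. -/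
theorem sum_fDiv_single_le (hn : 2 ≤ n) (hf : ConvexOn ℝ (Set.Ici 0) f)
    (hμ : μ ∈ stdSimplex ℝ (∀ i, S i))
    (hc : Contracts f (1 - 1 / (C * n)) (down (Σ i, S i) n (n - 1)) (hom μ))
    (e : Slice (Fin n) 2) (h : Slice (Σ i, S i) 2 → ℝ)
    (hν : (fun x => μ x * h (res e x)) ∈ stdSimplex ℝ (∀ i, S i)) :
    ∑ i ∈ e.1, fDiv f (push (res (single i)) fun x => μ x * h (res e x))
        (push (res (single i)) μ) ≤
      (2 - 1 / C) * fDiv f (fun x => μ x * h (res e x)) μ := by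
  set ν : (∀ i, S i) → ℝ := fun x => μ x * h (res e x) with hνdef
  have hac : ∀ x, μ x = 0 → ν x = 0 := fun x hx => by simp [hνdef, hx]
  obtain ⟨x₀⟩ : Nonempty (∀ i, S i) := by
    by_contra hX
    have := not_nonempty_iff.1 hX
    simpa using hμ.2
  have hmono : ∀ {l : ℕ} (e' : Slice (Fin n) l) (k : Fin n), e'.1 ⊆ (coSingle k).1 →
      fDiv f (push (res e') ν) (push (res e') μ) ≤
        fDiv f (push (res (coSingle k)) ν) (push (res (coSingle k)) μ) := by
    intro l e' k hsub
    have : Nonempty (Slice (Σ i, S i) l) := ⟨res e' x₀⟩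
    exact fDiv_push_le_of_factorsThrough hf (res_factorsThrough hsub) hν.1 hμ.1 hac
  have hfull : fDiv f (push (res e) ν) (push (res e) μ) = fDiv f ν μ :=
    fDiv_push_mul_comp f (res e) μ h
  have htot := sum_fDiv_coSingle_le hn hμ hc hν hac
  rw [← Finset.sum_add_sum_compl e.1] at htot
  have hout : ((n : ℝ) - 2) * fDiv f ν μ ≤
      ∑ k ∈ e.1ᶜ, fDiv f (push (res (coSingle k)) ν) (push (res (coSingle k)) μ) := by
    have h1 : ∀ k ∈ e.1ᶜ, fDiv f ν μ ≤
        fDiv f (push (res (coSingle k)) ν) (push (res (coSingle k)) μ) := by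
      intro k hk
      rw [← hfull]
      exact hmono e k fun i hi => Finset.mem_erase.2
        ⟨fun hik => Finset.mem_compl.1 hk (hik ▸ hi), Finset.mem_univ i⟩
    have h2 := Finset.card_nsmul_le_sum _ _ _ h1
    rwa [nsmul_eq_mul, Finset.card_compl, e.2, Fintype.card_fin, Nat.cast_sub hn,
      Nat.cast_ofNat] at h2
  -- The terms are matched crosswise: deleting one element of the pair leaves the other visible.
  have hin : ∑ i ∈ e.1, fDiv f (push (res (single i)) ν) (push (res (single i)) μ) ≤
      ∑ k ∈ e.1, fDiv f (push (res (coSingle k)) ν) (push (res (coSingle k)) μ) := by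
    obtain ⟨i, j, hij, he⟩ := Finset.card_eq_two.1 e.2
    rw [he, Finset.sum_pair hij, Finset.sum_pair hij, add_comm]
    exact add_le_add
      (hmono _ _ (single_subset.2 (Finset.mem_erase.2 ⟨hij.symm, Finset.mem_univ j⟩)))
      (hmono _ _ (single_subset.2 (Finset.mem_erase.2 ⟨hij, Finset.mem_univ i⟩)))
  linarith

theorem sum_excess_single_le (hn : 2 ≤ n) (hf : IsEntropy f)
    (hμ : μ ∈ stdSimplex ℝ (∀ i, S i))
    (hc : Contracts f (1 - 1 / (C * n)) (down (Σ i, S i) n (n - 1)) (hom μ))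
    (e : Slice (Fin n) 2) (h : Slice (Σ i, S i) 2 → ℝ) (h0 : ∀ A, 0 ≤ h A) :
    ∑ i ∈ e.1, excess f (push (res (single i)) fun x => μ x * h (res e x))
        (push (res (single i)) μ) ≤
      (2 - 1 / C) * excess f (fun x => μ x * h (res e x)) μ := by
  set ν : (∀ i, S i) → ℝ := fun x => μ x * h (res e x) with hνdef
  have hac : ∀ x, μ x = 0 → ν x = 0 := fun x hx => by simp [hνdef, hx]
  have hν0 : ∀ x, 0 ≤ ν x := fun x => mul_nonneg (hμ.1 x) (h0 _)
  rcases (Finset.sum_nonneg fun x _ => hν0 x : 0 ≤ ∑ x, ν x).eq_or_lt with hz | hpos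
  · have hν : ∀ x, ν x = 0 := fun x =>
      (Finset.sum_eq_zero_iff_of_nonneg fun x _ => hν0 x).1 hz.symm x (Finset.mem_univ x)
    have hν' : ν = fun _ => 0 := funext hν
    rw [hν', excess_zero hμ, mul_zero]
    refine (Finset.sum_eq_zero fun i _ => ?_).le
    have : push (res (single i)) (fun _ : (∀ i, S i) => (0 : ℝ)) = fun _ => 0 := by
      funext t
      simp [push]
    rw [this, excess_zero (push_mem_stdSimplex _ hμ)]
  · set c := (∑ x, ν x)⁻¹ with hcdef
    have hcpos : 0 < c := inv_pos.2 hpos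
    obtain ⟨κ, hκ, p, q, hsc⟩ := hf.scaling c hcpos
    have hcν : (fun x => c * ν x) = fun x => μ x * (fun A => c * h A) (res e x) := by
      funext x
      simp only [hνdef]
      ring
    have hmass : ∑ x, c * ν x = 1 := by
      rw [← Finset.mul_sum, hcdef, inv_mul_cancel₀ hpos.ne']
    have hsimp : (fun x => μ x * (fun A => c * h A) (res e x)) ∈ stdSimplex ℝ (∀ i, S i) := by
      rw [← hcν]
      exact ⟨fun x => mul_nonneg hcpos.le (hν0 x), hmass⟩
    have key := sum_fDiv_single_le hn hf.convexOn hμ hc e (fun A => c * h A) hsimp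
    rw [← hcν] at key
    have hf1 : f 1 = 0 := hf.one
    have hE : fDiv f (fun x => c * ν x) μ = κ * excess f ν μ := by
      rw [← excess_const_mul hsc hμ hν0 hac, excess, hmass, hf1, sub_zero]
    have hEi : ∀ i, fDiv f (push (res (single i)) fun x => c * ν x) (push (res (single i)) μ) =
        κ * excess f (push (res (single i)) ν) (push (res (single i)) μ) := by
      intro i
      rw [← excess_const_mul hsc (push_mem_stdSimplex _ hμ) (push_nonneg hν0)
        (fun t => push_eq_zero_of_push_eq_zero hμ.1 hac), excess, ← push_const_mul, sum_push,
        hmass, hf1, sub_zero]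
    rw [hE, Finset.sum_congr rfl fun i _ => hEi i, ← Finset.mul_sum, mul_left_comm] at key
    exact le_of_mul_le_mul_left key hκ

end tensorization

universe u

/-! ### Contraction of the down step from pairs to points. -/

section contraction

variable {n : ℕ} {S : Fin n → Type u} [∀ i, Fintype (S i)] [∀ i, DecidableEq (S i)]

theorem sum_edges_comm (G : Fin n → Slice (Fin n) 2 → ℝ) :
    ∑ e : Slice (Fin n) 2, ∑ i ∈ e.1, G i e = ∑ i, ∑ e : Slice (Fin n) 2 with i ∈ e.1, G i e :=
  Finset.sum_comm' (by simp)

/-- A random endpoint of a random edge is a uniform vertex `i`, and given `i` the edge is uniform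
among the `n - 1` edges at `i`. -/
theorem sum_push_vecMul_down (hn : 2 ≤ n) (N : Slice (Fin n) 2 → (∀ i, S i) → ℝ) :
    (fun A => 1 / (n.choose 2 : ℝ) * ∑ e, push (res e) (N e) A) ᵥ* down (Σ i, S i) 2 1 =
      fun B => 1 / (n : ℝ) * ∑ i, push (res (single i))
        (fun x => 1 / ((n : ℝ) - 1) * ∑ e : Slice (Fin n) 2 with i ∈ e.1, N e x) B := by
  funext B
  have hn2 : (2 : ℝ) ≤ n := by exact_mod_cast hn
  have h1 : ((fun A => 1 / (n.choose 2 : ℝ) * ∑ e, push (res e) (N e) A) ᵥ*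
      down (Σ i, S i) 2 1) B =
      1 / (n.choose 2 : ℝ) * ∑ e, (push (res e) (N e) ᵥ* down (Σ i, S i) 2 1) B := by
    simp only [Matrix.vecMul, dotProduct, mul_assoc, Finset.sum_mul, ← Finset.mul_sum]
    rw [Finset.sum_comm]
  rw [h1]
  simp only [push_res_vecMul_down, sum_slice_one_subset, push_sum]
  rw [← Finset.mul_sum, sum_edges_comm fun i e => push (res (single i)) (N e) B, ← Finset.mul_sum,
    Nat.cast_choose_two]
  have h2 : (n : ℝ) - 1 ≠ 0 := by linarith
  have h3 : (n : ℝ) ≠ 0 := by linarith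
  norm_num
  field_simp

theorem card_slice_two_eq_choose : (Fintype.card (Slice (Fin n) 2) : ℝ) = n.choose 2 := by
  rw [card_slice_two, Fintype.card_fin, Nat.cast_choose_two]

variable {μ : (∀ i, S i) → ℝ} {f : ℝ → ℝ} {C : ℝ}

theorem marginal_two_vecMul_down (hn : 2 ≤ n) (μ : (∀ i, S i) → ℝ) :
    marginal 2 (hom μ) ᵥ* down (Σ i, S i) 2 1 =
      fun B => 1 / (n : ℝ) * ∑ i, push (res (single i)) μ B := by
  have hn2 : (2 : ℝ) ≤ n := by exact_mod_cast hn
  have h2 : (n : ℝ) - 1 ≠ 0 := by linarith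
  rw [funext (marginal_hom (l := 2) μ), sum_push_vecMul_down hn fun _ => μ]
  simp only [Finset.sum_const, nsmul_eq_mul, card_edges_at, Fintype.card_fin, ← mul_assoc,
    one_div_mul_cancel h2, one_mul]

theorem excess_push_avg_le (hn : 2 ≤ n) (hf : IsEntropy.{u} f) (hμ : μ ∈ stdSimplex ℝ (∀ i, S i))
    {N : Slice (Fin n) 2 → (∀ i, S i) → ℝ} (hN : ∀ e x, 0 ≤ N e x)
    (hac : ∀ e x, μ x = 0 → N e x = 0) (i : Fin n) :
    excess f (push (res (single i)) fun x =>
        1 / ((n : ℝ) - 1) * ∑ e : Slice (Fin n) 2 with i ∈ e.1, N e x)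
        (push (res (single i)) μ) ≤
      1 / ((n : ℝ) - 1) * ∑ e : Slice (Fin n) 2 with i ∈ e.1,
        excess f (push (res (single i)) (N e)) (push (res (single i)) μ) := by
  have hn2 : (2 : ℝ) ≤ n := by exact_mod_cast hn
  have h1 : (0 : ℝ) < n - 1 := by linarith
  have hJ := (hf.excess_convexOn (push (res (single i)) μ)
    (push_mem_stdSimplex (res (single i)) hμ)).map_sum_le
    (t := Finset.univ.filter fun e : Slice (Fin n) 2 => i ∈ e.1)
    (w := fun _ => 1 / ((n : ℝ) - 1)) (p := fun e => push (res (single i)) (N e))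
    (fun _ _ => by positivity)
    (by rw [Finset.sum_const, nsmul_eq_mul, card_edges_at, Fintype.card_fin,
      mul_one_div_cancel h1.ne'])
    (fun e _ => ⟨push_nonneg (hN e), fun t => push_eq_zero_of_push_eq_zero hμ.1 (hac e)⟩)
  rw [push_sum]
  simp only [smul_eq_mul, ← Finset.mul_sum, ← Finset.smul_sum] at hJ
  refine le_trans (le_of_eq ?_) hJ
  congr 1
  funext t
  simp [Finset.sum_apply]

theorem contracts_two_one (hn : 2 ≤ n) (hf : IsEntropy.{u} f) (hμ : μ ∈ stdSimplex ℝ (∀ i, S i))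
    (hC : 0 < C) (hc : Contracts f (1 - 1 / (C * n)) (down (Σ i, S i) n (n - 1)) (hom μ)) :
    Contracts f (1 - 1 / (2 * (C + 1))) (down (Σ i, S i) 2 1) (marginal 2 (hom μ)) := by
  intro ν hν hac
  have hn2 : (2 : ℝ) ≤ n := by exact_mod_cast hn
  have hn1 : (0 : ℝ) < n - 1 := by linarith
  have hn0 : (0 : ℝ) < n := by linarith
  have hch : (n.choose 2 : ℝ) ≠ 0 := by
    have := Nat.choose_pos hn
    positivity
  set m₂ := marginal 2 (hom μ) with hm₂
  have hm : m₂ = fun A => 1 / (n.choose 2 : ℝ) * ∑ e : Slice (Fin n) 2, push (res e) μ A :=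
    funext (marginal_hom μ)
  have hm0 : ∀ A, 0 ≤ m₂ A := by
    intro A
    rw [hm]
    exact mul_nonneg (by positivity) (Finset.sum_nonneg fun e _ => push_nonneg hμ.1 A)
  set h : Slice (Σ i, S i) 2 → ℝ := fun A => ν A / m₂ A with hh
  have h0 : ∀ A, 0 ≤ h A := fun A => div_nonneg (hν.1 A) (hm0 A)
  set N : Slice (Fin n) 2 → (∀ i, S i) → ℝ := fun e x => μ x * h (res e x) with hNdef
  have hN0 : ∀ e x, 0 ≤ N e x := fun e x => mul_nonneg (hμ.1 x) (h0 _)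
  have hNac : ∀ e x, μ x = 0 → N e x = 0 := fun e x hx => by simp [hNdef, hx]
  -- The same density `h` is used on every block; only the mass `a e` varies.
  have hνeq : ν = fun A => 1 / (n.choose 2 : ℝ) * ∑ e, push (res e) (N e) A := by
    funext A
    simp only [hNdef, push_mul_comp]
    rw [← Finset.sum_mul, ← mul_assoc, ← congrFun hm A, hh]
    by_cases hA : m₂ A = 0
    · simp [hA, hac A hA]
    · exact (mul_div_cancel₀ _ hA).symm
  set a : Slice (Fin n) 2 → ℝ := fun e => ∑ x, N e x with ha
  have ha0 : ∀ e, 0 ≤ a e := fun e => Finset.sum_nonneg fun x _ => hN0 e x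
  have hasum : ∑ e, a e = Fintype.card (Slice (Fin n) 2) := by
    have h1 : ∑ A, ν A = 1 / (n.choose 2 : ℝ) * ∑ e, a e := by
      rw [hνeq]
      simp only [← Finset.mul_sum]
      rw [Finset.sum_comm]
      simp only [sum_push, ha]
    rw [hν.2] at h1
    rw [card_slice_two_eq_choose]
    field_simp at h1
    linarith
  -- the divergence of `ν`
  have hF2 : fDiv f ν m₂ =
      1 / (n.choose 2 : ℝ) * (∑ e, f (a e) + ∑ e, excess f (N e) μ) := by
    rw [hm, hνeq, fDiv_const_mul _ _ _ (one_div_ne_zero hch),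
      fDiv_sum_push f (fun e : Slice (Fin n) 2 => res e) (fun _ _ _ _ h => eq_of_res_eq h) N
        (fun _ => μ), ← Finset.sum_add_distrib]
    congr 1
    refine Finset.sum_congr rfl fun e _ => ?_
    rw [excess, add_sub_cancel]
    exact fDiv_push_mul_comp f (res e) μ h
  -- the divergence after the down step
  set M : Fin n → (∀ i, S i) → ℝ := fun i x =>
    1 / ((n : ℝ) - 1) * ∑ e : Slice (Fin n) 2 with i ∈ e.1, N e x with hM
  have hmass : ∀ i, ∑ x, M i x = vertexAvg a i := by
    intro i
    simp only [hM, ha, vertexAvg]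
    rw [← Finset.mul_sum, Finset.sum_comm, one_div_mul_eq_div]
  have hF1 : fDiv f (ν ᵥ* down (Σ i, S i) 2 1) (m₂ ᵥ* down (Σ i, S i) 2 1) =
      1 / (n : ℝ) * (∑ i, f (vertexAvg a i) +
        ∑ i, excess f (push (res (single i)) (M i)) (push (res (single i)) μ)) := by
    rw [hm₂, marginal_two_vecMul_down hn, hνeq, sum_push_vecMul_down hn,
      fDiv_const_mul _ _ _ (one_div_ne_zero hn0.ne'),
      fDiv_sum_push f (fun i : Fin n => res (single i))
        (fun _ _ _ _ h => single_bijective.1 (eq_of_res_eq h)) M (fun _ => μ),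
      ← Finset.sum_add_distrib]
    congr 1
    refine Finset.sum_congr rfl fun i _ => ?_
    rw [excess, sum_push, hmass, add_sub_cancel]
  have hexc : ((n : ℝ) - 1) *
      ∑ i, excess f (push (res (single i)) (M i)) (push (res (single i)) μ) ≤
      (2 - 1 / C) * ∑ e, excess f (N e) μ := by
    calc _ ≤ ((n : ℝ) - 1) * ∑ i, 1 / ((n : ℝ) - 1) * ∑ e : Slice (Fin n) 2 with i ∈ e.1,
          excess f (push (res (single i)) (N e)) (push (res (single i)) μ) :=
          mul_le_mul_of_nonneg_left
            (Finset.sum_le_sum fun i _ => excess_push_avg_le hn hf hμ hN0 hNac i) hn1.le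
      _ = ∑ e : Slice (Fin n) 2, ∑ i ∈ e.1,
          excess f (push (res (single i)) (N e)) (push (res (single i)) μ) := by
          rw [← Finset.mul_sum, ← mul_assoc, mul_one_div_cancel hn1.ne', one_mul,
            sum_edges_comm fun i e =>
              excess f (push (res (single i)) (N e)) (push (res (single i)) μ)]
      _ ≤ ∑ e, (2 - 1 / C) * excess f (N e) μ :=
          Finset.sum_le_sum fun e _ => sum_excess_single_le hn hf hμ hc e h h0
      _ = _ := by rw [Finset.mul_sum]
  have hedge : ((n : ℝ) - 1) * ∑ i, f (vertexAvg a i) ≤ ∑ e, f (a e) := hf.edge hn a ha0 hasum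
  have hE : 0 ≤ ∑ e, excess f (N e) μ :=
    Finset.sum_nonneg fun e _ => excess_nonneg hf.convexOn (hN0 e) hμ (hNac e)
  have hΦ : 0 ≤ ∑ e, f (a e) := by
    obtain ⟨d, hd⟩ := hf.tangent
    have h1 := Finset.sum_le_sum fun e (_ : e ∈ Finset.univ) => hd (a e) (ha0 e)
    rw [← Finset.mul_sum, Finset.sum_sub_distrib, hasum] at h1
    simpa using h1
  -- The first bound serves the block means, the second the inner entropies.
  have hρ1 : 1 / (C + 1) ≤ 1 := (div_le_one (by linarith)).2 (by linarith)
  have hρ2 : 1 / (C + 1) ≤ 1 / C := one_div_le_one_div_of_le hC (by linarith)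
  have hρ : 1 / (2 * (C + 1)) = 1 / (C + 1) / 2 := by
    field_simp
  rw [hF1, hF2, Nat.cast_choose_two, hρ]
  have hfin : ((n : ℝ) - 1) * (∑ i, f (vertexAvg a i) +
      ∑ i, excess f (push (res (single i)) (M i)) (push (res (single i)) μ)) ≤
      (2 - 1 / (C + 1)) * (∑ e, f (a e) + ∑ e, excess f (N e) μ) := by
    nlinarith [mul_le_mul_of_nonneg_right hρ1 hΦ, mul_le_mul_of_nonneg_right hρ2 hE]
  have hfin2 := mul_le_mul_of_nonneg_left hfin
    (by positivity : (0 : ℝ) ≤ 1 / (n * (n - 1)))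
  refine le_trans (le_of_eq ?_) (hfin2.trans (le_of_eq ?_))
  · field_simp
  · have : C + 1 ≠ 0 := by linarith
    field_simp

end contraction

/-! ### The second eigenvalue: variational bound and diagonal conjugation. -/

section spectral

/-- The variational bound on the second eigenvalue of a symmetric matrix. -/
theorem lambda2_le {ι : Type*} [Fintype ι] [DecidableEq ι] {A : Matrix ι ι ℝ}
    (hA : A.IsHermitian) (hι : 2 ≤ Fintype.card ι) (w : ι → ℝ) {ρ : ℝ}
    (h : ∀ v : ι → ℝ, w ⬝ᵥ v = 0 → v ⬝ᵥ (A *ᵥ v) ≤ ρ * (v ⬝ᵥ v)) : lambda2 A ≤ ρ := by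
  have hs := hA.sort_roots_charpoly_eq_eigenvalues₀
  have hre : Multiset.map (RCLike.re : ℝ → ℝ) A.charpoly.roots = A.charpoly.roots := by
    simp
  rw [hre] at hs
  have h1 : lambda2 A = hA.eigenvalues₀ ⟨1, by omega⟩ := by
    rw [lambda2, hs, List.getD_eq_getElem _ _ (by rw [List.length_ofFn]; omega), List.getElem_ofFn]
  set φ := Fintype.equivOfCardEq (Fintype.card_fin (Fintype.card ι)) with hφ
  set i := φ ⟨1, by omega⟩ with hi
  set j := φ ⟨0, by omega⟩ with hj
  have hij : i ≠ j := fun h => by simpa using φ.injective h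
  have hli : hA.eigenvalues i = hA.eigenvalues₀ ⟨1, by omega⟩ := by
    simp only [Matrix.IsHermitian.eigenvalues, hi, hφ, Equiv.symm_apply_apply]
  have hlj : hA.eigenvalues j = hA.eigenvalues₀ ⟨0, by omega⟩ := by
    simp only [Matrix.IsHermitian.eigenvalues, hj, hφ, Equiv.symm_apply_apply]
  have hle : hA.eigenvalues i ≤ hA.eigenvalues j := by
    rw [hli, hlj]
    exact hA.eigenvalues₀_antitone (by simp)
  rw [h1, ← hli]
  set b : ι → ι → ℝ := fun k => (hA.eigenvectorBasis k).ofLp with hb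
  have horth : ∀ k l, b k ⬝ᵥ b l = if k = l then 1 else 0 := by
    intro k l
    rw [← orthonormal_iff_ite.1 hA.eigenvectorBasis.orthonormal k l,
      EuclideanSpace.inner_eq_star_dotProduct, dotProduct_comm]
    simp [hb]
  have heig : ∀ k, A *ᵥ b k = hA.eigenvalues k • b k := hA.mulVec_eigenvectorBasis
  -- The span of the top two eigenvectors is two-dimensional, so it contains a nonzero vector
  -- orthogonal to `w`.
  obtain ⟨p, q, hpq, horthw⟩ : ∃ p q : ℝ, 0 < p ^ 2 + q ^ 2 ∧
      p * (w ⬝ᵥ b i) + q * (w ⬝ᵥ b j) = 0 := by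
    by_cases h0 : w ⬝ᵥ b i = 0
    · exact ⟨1, 0, by norm_num, by simp [h0]⟩
    · exact ⟨w ⬝ᵥ b j, -(w ⬝ᵥ b i), by rw [neg_sq]; positivity, by ring⟩
  have hv := h (p • b i + q • b j) (by
    rw [dotProduct_add, dotProduct_smul, dotProduct_smul]
    exact horthw)
  simp only [Matrix.mulVec_add, Matrix.mulVec_smul, heig, dotProduct_add, add_dotProduct,
    dotProduct_smul, smul_dotProduct, horth, hij, hij.symm, if_true, if_false, smul_eq_mul] at hv
  have h2 := mul_le_mul_of_nonneg_left hle (sq_nonneg q)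
  refine le_of_mul_le_mul_right ?_ hpq
  linarith

theorem lambda2_conj {ι : Type*} [Fintype ι] [DecidableEq ι] (A : Matrix ι ι ℝ) {s : ι → ℝ}
    (hs : ∀ i, s i ≠ 0) :
    lambda2 (Matrix.of fun i j => (s i)⁻¹ * A i j * s j) = lambda2 A := by
  have h : (Matrix.of fun i j => (s i)⁻¹ * A i j * s j) =
      Matrix.diagonal (fun i => (s i)⁻¹) * (A * Matrix.diagonal s) := by
    ext i j
    simp [Matrix.diagonal_mul, Matrix.mul_diagonal, mul_assoc]
  have h2 : (A * Matrix.diagonal s) * Matrix.diagonal (fun i => (s i)⁻¹) = A := by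
    ext i j
    simp [Matrix.mul_diagonal, hs]
  rw [lambda2, lambda2, h, Matrix.charpoly_mul_comm, h2]

end spectral

/-! ### From χ²-contraction to the spectrum of the up-down walk. -/

section walk

variable {α : Type*} [DecidableEq α] {k l : ℕ}

theorem down_nonneg (A : Slice α k) (B : Slice α l) : 0 ≤ down α k l A B := by
  simp only [down, Matrix.of_apply]
  split_ifs <;> positivity

variable [Fintype α] {m : Slice α k → ℝ} {ρ : ℝ}

theorem down_row_sum (hl : l ≤ k) (A : Slice α k) : ∑ B, down α k l A B = 1 := by
  have h1 : ∑ B : Slice α l, (if B.1 ⊆ A.1 then (1 : ℝ) else 0) = k.choose l := by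
    have h2 : ∑ B : Slice α l, (if B.1 ⊆ A.1 then (1 : ℝ) else 0) =
        ∑ B ∈ Finset.powersetCard l (Finset.univ : Finset α), if B ⊆ A.1 then (1 : ℝ) else 0 :=
      (Finset.sum_subtype _ (by simp) fun B : Finset α => if B ⊆ A.1 then (1 : ℝ) else 0).symm
    rw [h2, Finset.sum_boole,
      show (Finset.powersetCard l (Finset.univ : Finset α)).filter (· ⊆ A.1) =
        Finset.powersetCard l A.1 by ext B; simp [Finset.mem_powersetCard, and_comm],
      Finset.card_powersetCard, A.2]
  have hch : (k.choose l : ℝ) ≠ 0 := by exact_mod_cast (Nat.choose_pos hl).ne'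
  have h3 : ∀ B, down α k l A B = 1 / (k.choose l : ℝ) * if B.1 ⊆ A.1 then (1 : ℝ) else 0 := by
    intro B
    simp [down]
  rw [Finset.sum_congr rfl fun B _ => h3 B, ← Finset.mul_sum, h1, one_div_mul_cancel hch]

theorem marginal_nonneg (hm : ∀ A, 0 ≤ m A) (B : Slice α l) : 0 ≤ marginal l m B :=
  Finset.sum_nonneg fun A _ => mul_nonneg (hm A) (down_nonneg A B)

theorem mul_down_eq_zero (hm : ∀ A, 0 ≤ m A) {B : Slice α l} (hB : marginal l m B = 0)
    (A : Slice α k) : m A * down α k l A B = 0 :=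
  (Finset.sum_eq_zero_iff_of_nonneg fun A _ => mul_nonneg (hm A) (down_nonneg A B)).1 hB A
    (Finset.mem_univ A)

/-- Contraction of variance along the up operator. -/
theorem sum_sq_up_le (hm : m ∈ stdSimplex ℝ (Slice α k))
    (hc : Contracts chiSq ρ (down α k l) m) {h : Slice α k → ℝ} (h0 : ∑ A, m A * h A = 0) :
    ∑ B : Slice α l, (∑ A, m A * h A * down α k l A B) ^ 2 / marginal l m B ≤
      ρ * ∑ A, m A * h A ^ 2 := by
  -- Dividing by `K` makes `1 + h / K` a nonnegative density. Both sides are quadratic in `h`, so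
  -- `K` cancels.
  set K := 1 + ∑ A, |h A| with hK
  have hKpos : 0 < K := by positivity
  have hhK : ∀ A, |h A| ≤ K := fun A => by
    have := Finset.single_le_sum (fun A _ => abs_nonneg (h A)) (Finset.mem_univ A)
    linarith
  set ν : Slice α k → ℝ := fun A => m A * (1 + h A / K) with hν
  have hνpos : ∀ A, 0 ≤ ν A := by
    intro A
    refine mul_nonneg (hm.1 A) ?_
    have : -1 ≤ h A / K := by
      rw [le_div_iff₀ hKpos]
      linarith [(abs_le.1 (hhK A)).1]
    linarith
  have hνsum : ∑ A, ν A = 1 := by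
    have : ∀ A, ν A = m A + K⁻¹ * (m A * h A) := fun A => by
      simp only [hν]
      ring
    rw [Finset.sum_congr rfl fun A _ => this A, Finset.sum_add_distrib, ← Finset.mul_sum, h0,
      hm.2, mul_zero, add_zero]
  have key := hc ν ⟨hνpos, hνsum⟩ fun A hA => by simp [hν, hA]
  have hR : fDiv chiSq ν m = (K ^ 2)⁻¹ * ∑ A, m A * h A ^ 2 := by
    rw [fDiv_mul_right chiSq m fun A => 1 + h A / K, Finset.mul_sum]
    refine Finset.sum_congr rfl fun A _ => ?_
    rw [chiSq]
    field_simp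
    ring
  have hL : fDiv chiSq (ν ᵥ* down α k l) (m ᵥ* down α k l) = (K ^ 2)⁻¹ *
      ∑ B : Slice α l, (∑ A, m A * h A * down α k l A B) ^ 2 / marginal l m B := by
    rw [fDiv, Finset.mul_sum]
    refine Finset.sum_congr rfl fun B _ => ?_
    have h1 : (ν ᵥ* down α k l) B =
        marginal l m B + K⁻¹ * ∑ A, m A * h A * down α k l A B := by
      simp only [marginal, Matrix.vecMul, dotProduct]
      rw [Finset.mul_sum, ← Finset.sum_add_distrib]
      refine Finset.sum_congr rfl fun A _ => ?_
      simp only [hν]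
      ring
    rw [h1, show (m ᵥ* down α k l) B = marginal l m B from rfl, chiSq]
    by_cases hB : marginal l m B = 0
    · simp [hB]
    · field_simp
      ring
  rw [hL, hR, mul_left_comm] at key
  exact le_of_mul_le_mul_left key (by positivity)

/-- Contraction of variance along the down operator, by duality. -/
theorem sum_sq_down_le (hm : m ∈ stdSimplex ℝ (Slice α k)) (hρ : 0 ≤ ρ)
    (hc : Contracts chiSq ρ (down α k l) m) {g : Slice α l → ℝ}
    (h0 : ∑ B, marginal l m B * g B = 0) :
    ∑ A, m A * (∑ B, down α k l A B * g B) ^ 2 ≤ ρ * ∑ B, marginal l m B * g B ^ 2 := by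
  set h : Slice α k → ℝ := fun A => ∑ B, down α k l A B * g B with hh
  have hdual : ∀ F : Slice α k → ℝ, ∑ A, m A * F A * h A =
      ∑ B, g B * ∑ A, m A * F A * down α k l A B := by
    intro F
    simp only [hh, Finset.mul_sum]
    rw [Finset.sum_comm]
    exact Finset.sum_congr rfl fun B _ => Finset.sum_congr rfl fun A _ => by ring
  have hmean : ∑ A, m A * h A = 0 := by
    have := hdual fun _ => 1
    simp only [mul_one] at this
    rw [this, ← h0]
    exact Finset.sum_congr rfl fun B _ => mul_comm _ _
  have hup := sum_sq_up_le hm hc hmean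
  set X := ∑ A, m A * h A ^ 2 with hX
  have hX0 : 0 ≤ X := Finset.sum_nonneg fun A _ => mul_nonneg (hm.1 A) (sq_nonneg _)
  set G := ∑ B, marginal l m B * g B ^ 2 with hG
  have hG0 : 0 ≤ G :=
    Finset.sum_nonneg fun B _ => mul_nonneg (marginal_nonneg hm.1 B) (sq_nonneg _)
  -- Cauchy–Schwarz for `X`, the inner product of `g` with the up operator applied to `h`. The bound
  -- on that operator returns a factor `X`, which is then divided out.
  have hCS : X ^ 2 ≤ G * ∑ B : Slice α l,
      (∑ A, m A * h A * down α k l A B) ^ 2 / marginal l m B := by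
    have h1 : X = ∑ B, g B * ∑ A, m A * h A * down α k l A B := by
      rw [← hdual, hX]
      exact Finset.sum_congr rfl fun A _ => by ring
    rw [h1]
    refine Finset.sum_sq_le_sum_mul_sum_of_sq_le_mul _
      (fun B _ => mul_nonneg (marginal_nonneg hm.1 B) (sq_nonneg _))
      (fun B _ => div_nonneg (sq_nonneg _) (marginal_nonneg hm.1 B)) fun B _ => ?_
    by_cases hB : marginal l m B = 0
    · have : ∀ A, m A * h A * down α k l A B = 0 := fun A => by
        rw [mul_right_comm, mul_down_eq_zero hm.1 hB, zero_mul]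
      simp [this]
    · refine le_of_eq ?_
      field_simp
  have h2 : X * X ≤ X * (ρ * G) := by
    have := mul_le_mul_of_nonneg_left hup hG0
    nlinarith
  rcases hX0.eq_or_lt with h3 | h3
  · rw [← h3]
    positivity
  · exact le_of_mul_le_mul_left h2 h3

theorem up_mul_down_apply (hl : l ≤ k) (B B' : Slice α l) :
    (up l m * down α k l) B B' =
      (marginal l m B)⁻¹ * ∑ A, m A * down α k l A B * down α k l A B' := by
  have hch : (k.choose l : ℝ) ≠ 0 := by exact_mod_cast (Nat.choose_pos hl).ne'
  have h1 : ∑ A' : Slice α k with B.1 ⊆ A'.1, m A' = k.choose l * marginal l m B := by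
    simp only [marginal, Matrix.vecMul, dotProduct, down, Matrix.of_apply]
    rw [Finset.mul_sum, Finset.sum_filter]
    refine Finset.sum_congr rfl fun A _ => ?_
    split_ifs
    · field_simp
    · simp
  rw [Matrix.mul_apply, Finset.mul_sum]
  refine Finset.sum_congr rfl fun A _ => ?_
  simp only [up, Matrix.of_apply]
  rw [h1]
  by_cases hBA : B.1 ⊆ A.1
  · rw [if_pos hBA, show down α k l A B = 1 / (k.choose l : ℝ) from if_pos hBA, div_eq_mul_inv,
      mul_inv]
    ring
  · rw [if_neg hBA, show down α k l A B = 0 from if_neg hBA]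
    ring

theorem lambda2_upDownWalk_le (hl : l ≤ k) (hm : m ∈ stdSimplex ℝ (Slice α k)) (hρ : 0 ≤ ρ)
    (hc : Contracts chiSq ρ (down α k l) m)
    (hcard : 2 ≤ Fintype.card {B : Slice α l // marginal l m B ≠ 0}) :
    lambda2 (upDownWalk l m) ≤ ρ := by
  set s : {B : Slice α l // marginal l m B ≠ 0} → ℝ := fun B => √(marginal l m B.1) with hs
  have hpos : ∀ B : {B : Slice α l // marginal l m B ≠ 0}, 0 < marginal l m B.1 := fun B =>
    (marginal_nonneg hm.1 B.1).lt_of_ne B.2.symm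
  have hs0 : ∀ B, s B ≠ 0 := fun B => (Real.sqrt_pos.2 (hpos B)).ne'
  have hss : ∀ B, s B ^ 2 = marginal l m B.1 := fun B => Real.sq_sqrt (hpos B).le
  -- Conjugation by the square root of the stationary law makes the reversible chain symmetric.
  set Q : Matrix {B : Slice α l // marginal l m B ≠ 0} {B : Slice α l // marginal l m B ≠ 0} ℝ :=
    Matrix.of fun B B' =>
      (s B)⁻¹ * (s B')⁻¹ * ∑ A, m A * down α k l A B.1 * down α k l A B'.1 with hQ
  have hconj : upDownWalk l m = Matrix.of fun B B' => (s B)⁻¹ * Q B B' * s B' := by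
    ext B B'
    simp only [upDownWalk, Matrix.submatrix_apply, up_mul_down_apply hl, hQ, Matrix.of_apply,
      ← hss]
    have := hs0 B
    have := hs0 B'
    field_simp
  rw [hconj, lambda2_conj Q hs0]
  refine lambda2_le (Matrix.IsHermitian.ext fun B B' => ?_) hcard s fun v hv => ?_
  · simp only [hQ, Matrix.of_apply, star_trivial]
    rw [mul_comm (s B')⁻¹]
    congr 1
    exact Finset.sum_congr rfl fun A _ => by ring
  -- With `g = v / s`, extended by zero, orthogonality of `v` to `s` says that `g` has mean zero.
  · set g : Slice α l → ℝ := fun B =>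
      if hB : marginal l m B ≠ 0 then (s ⟨B, hB⟩)⁻¹ * v ⟨B, hB⟩ else 0 with hg
    have hgB : ∀ B : {B : Slice α l // marginal l m B ≠ 0}, g B.1 = (s B)⁻¹ * v B := fun B => by
      simp only [hg, dif_pos B.2]
    have hgz : ∀ B, ¬ marginal l m B ≠ 0 → g B = 0 := fun B hB => by
      simp only [hg, dif_neg hB]
    have hsub : ∀ F : Slice α l → ℝ, (∀ B, ¬ marginal l m B ≠ 0 → F B = 0) →
        ∑ B, F B = ∑ B : {B : Slice α l // marginal l m B ≠ 0}, F B.1 := by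
      intro F hF
      rw [← Finset.sum_subtype (Finset.univ.filter fun B => marginal l m B ≠ 0) (by simp) F,
        Finset.sum_filter_of_ne]
      intro B _ hne hB
      exact hne (hF B (not_not.2 hB))
    have h0 : ∑ B, marginal l m B * g B = 0 := by
      rw [hsub _ fun B hB => by rw [hgz B hB, mul_zero]]
      refine Eq.trans ?_ hv
      refine Finset.sum_congr rfl fun B _ => ?_
      rw [hgB, ← hss]
      have := hs0 B
      field_simp
    have key := sum_sq_down_le hm hρ hc h0
    have h1 : ∑ B, marginal l m B * g B ^ 2 = v ⬝ᵥ v := by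
      rw [hsub (fun B => marginal l m B * g B ^ 2) fun B hB => by simp [hgz B hB], dotProduct]
      refine Finset.sum_congr rfl fun B _ => ?_
      rw [hgB, ← hss]
      have := hs0 B
      field_simp
    have h2 : ∑ A, m A * (∑ B, down α k l A B * g B) ^ 2 = v ⬝ᵥ (Q *ᵥ v) := by
      have h3 : ∀ A, ∑ B, down α k l A B * g B =
          ∑ B : {B : Slice α l // marginal l m B ≠ 0}, down α k l A B.1 * ((s B)⁻¹ * v B) := by
        intro A
        rw [hsub _ fun B hB => by rw [hgz B hB, mul_zero]]
        exact Finset.sum_congr rfl fun B _ => by rw [hgB]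
      simp only [h3, dotProduct, Matrix.mulVec, hQ, Matrix.of_apply, sq,
        Finset.mul_sum, Finset.sum_mul]
      rw [Finset.sum_comm]
      refine Finset.sum_congr rfl fun B _ => ?_
      rw [Finset.sum_comm]
      exact Finset.sum_congr rfl fun B' _ => Finset.sum_congr rfl fun A _ => by ring
    rwa [h1, h2] at key

end walk

/-! ### The stationary law and its support. -/

section main

variable {n : ℕ} {S : Fin n → Type*} [∀ i, Fintype (S i)] [∀ i, DecidableEq (S i)]
  {μ : (∀ i, S i) → ℝ}

theorem marginal_hom_mem_stdSimplex {l : ℕ} (hl : l ≤ n) (hμ : μ ∈ stdSimplex ℝ (∀ i, S i)) :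
    marginal l (hom μ) ∈ stdSimplex ℝ (Slice (Σ i, S i) l) := by
  have hh : hom μ ∈ stdSimplex ℝ (Slice (Σ i, S i) n) := push_mem_stdSimplex toSlice hμ
  refine ⟨marginal_nonneg hh.1, ?_⟩
  simp only [marginal, Matrix.vecMul, dotProduct]
  rw [Finset.sum_comm]
  simp only [← Finset.mul_sum, down_row_sum hl, mul_one, hh.2]

/-- Any point of the support of `μ` supplies `n` distinct vertices. With fewer than two states
`lambda2` would take its default value `1` and the bound would fail. -/
theorem two_le_card_support (hn : 2 ≤ n) (hμ : μ ∈ stdSimplex ℝ (∀ i, S i)) :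
    2 ≤ Fintype.card {B : Slice (Σ i, S i) 1 // marginal 1 (marginal 2 (hom μ)) B ≠ 0} := by
  obtain ⟨x, -, hx⟩ : ∃ x ∈ Finset.univ, μ x ≠ 0 :=
    Finset.exists_ne_zero_of_sum_ne_zero (by rw [hμ.2]; exact one_ne_zero)
  have hxpos : 0 < μ x := (hμ.1 x).lt_of_ne hx.symm
  have hn0 : (0 : ℝ) < n := by exact_mod_cast (by omega : 0 < n)
  have hpos : ∀ i, marginal 1 (marginal 2 (hom μ)) (res (single i) x) ≠ 0 := by
    intro i
    have h1 : marginal 1 (marginal 2 (hom μ)) (res (single i) x) =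
        1 / (n : ℝ) * ∑ j, push (res (single j)) μ (res (single i) x) :=
      congrFun (marginal_two_vecMul_down hn μ) _
    have h2 : μ x ≤ push (res (single i)) μ (res (single i) x) :=
      Finset.single_le_sum (fun y _ => hμ.1 y) (by simp)
    have h3 : push (res (single i)) μ (res (single i) x) ≤
        ∑ j, push (res (single j)) μ (res (single i) x) :=
      Finset.single_le_sum (f := fun j => push (res (single j)) μ (res (single i) x))
        (fun j _ => push_nonneg hμ.1 _) (Finset.mem_univ i)
    rw [h1]
    have : 0 < ∑ j, push (res (single j)) μ (res (single i) x) := by linarith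
    positivity
  have hinj : Function.Injective fun i : Fin n =>
      (⟨res (single i) x, hpos i⟩ :
        {B : Slice (Σ i, S i) 1 // marginal 1 (marginal 2 (hom μ)) B ≠ 0}) := fun i j hij =>
    single_bijective.1 (eq_of_res_eq (congrArg Subtype.val hij))
  have := Fintype.card_le_of_injective _ hinj
  rw [Fintype.card_fin] at this
  omega

end main

end DownUp

end

theorem mainTheorem5 {n : ℕ} (hn : 2 ≤ n) {S : Fin n → Type*}
    [∀ i, Fintype (S i)] [∀ i, DecidableEq (S i)]
    (μ : (∀ i, S i) → ℝ) (hμ : μ ∈ stdSimplex ℝ (∀ i, S i)) (C : ℝ) (hC : 0 < C) :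
    (DownUp.Contracts DownUp.chiSq (1 - 1 / (C * n)) (DownUp.down (Σ i, S i) n (n - 1))
        (DownUp.hom μ) →
      DownUp.Contracts DownUp.chiSq (1 - 1 / (2 * (C + 1))) (DownUp.down (Σ i, S i) 2 1)
        (DownUp.marginal 2 (DownUp.hom μ)) ∧
      DownUp.lambda2 (DownUp.upDownWalk 1 (DownUp.marginal 2 (DownUp.hom μ)))
        ≤ 1 - 1 / (2 * (C + 1))) ∧
    (DownUp.Contracts DownUp.kl (1 - 1 / (C * n)) (DownUp.down (Σ i, S i) n (n - 1))
        (DownUp.hom μ) →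
      DownUp.Contracts DownUp.kl (1 - 1 / (2 * (C + 1))) (DownUp.down (Σ i, S i) 2 1)
        (DownUp.marginal 2 (DownUp.hom μ))) := by
  have hρ : (0 : ℝ) ≤ 1 - 1 / (2 * (C + 1)) := by
    rw [sub_nonneg, div_le_one (by linarith)]
    linarith
  refine ⟨fun hc => ?_, DownUp.contracts_two_one hn DownUp.isEntropy_kl hμ hC⟩
  have h := DownUp.contracts_two_one hn DownUp.isEntropy_chiSq hμ hC hc
  exact ⟨h, DownUp.lambda2_upDownWalk_le one_le_two
    (DownUp.marginal_hom_mem_stdSimplex hn hμ) hρ h (DownUp.two_le_card_support hn hμ)⟩
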